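/- Let $d\ge 1$. A \emph{$d$-rectangle} is a set $I_1\times\dots\times I_d\subset[0,1[^d$ in which every $I_i$ is a nonempty interval of the form $[a,b[\,\subset[0,1[$. Let $\operatorname{Rec}_d$ be the group, under composition, of all permutations $f$ of $[0,1[^d$ for which there is a finite partition of $[0,1[^d$ into $d$-rectangles such that $f$ is a translation on each of them, and let $D(\operatorname{Rec}_d)$ be its derived (commutator) subgroup. Let $\operatorname{IET}$ be the group of interval exchange transformations of $[0,1[$, that is, of all permutations $s$ of $[0,1[$ for which there is a finite partition of $[0,1[$ into intervals $[a,b[$ such that $s$ is a translation on each of them; $\operatorname{IET}^d$ acts on $[0,1[^d$ by $(s_1,\dots,s_d)(x_1,\dots,x_d)=(s_1(x_1),\dots,s_d(x_d))$. A \emph{rectangle transposition} is a permutation of $[0,1[^d$ which, for some disjoint $d$-rectangles $P,Q$ that are translates of each other, exchanges $P$ and $Q$, is a translation on each of $P$ and $Q$, and is the identity outside $P\cup Q$. Let $\operatorname{GtG}_d$ be the group generated by (the image of) $\operatorname{IET}^d$ together with all rectangle transpositions. Then $\operatorname{GtG}_d$ is a subgroup of $\operatorname{Rec}_d$, it is normal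 in $\operatorname{Rec}_d$, and it contains $D(\operatorname{Rec}_d)$. If $d\ge 2$, both inclusions $D(\operatorname{Rec}_d)\subset\operatorname{GtG}_d\subset\operatorname{Rec}_d$ are strict. -/

import Mathlib

namespace RectExchange

/-- The half-open unit interval `[0,1[`. -/
abbrev UnitIco : Type := Set.Ico (0 : ℝ) 1

/-- The half-open unit cube `[0,1[^d`. -/
abbrev Cube (d : ℕ) : Type := Fin d → UnitIco

/-- A (nonempty) interval `[a,b[` contained in `[0,1[`. -/
def IsHalfOpenInterval (I : Set UnitIco) : Prop :=
  ∃ a b : ℝ, 0 ≤ a ∧ a < b ∧ b ≤ 1 ∧ I = {x : UnitIco | a ≤ (x : ℝ) ∧ (x : ℝ) < b}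

/-- A `d`-rectangle: a product `I₁ × ⋯ × I_d` of (nonempty) half-open subintervals of `[0,1[`. -/
def IsRectangle {d : ℕ} (R : Set (Cube d)) : Prop :=
  ∃ I : Fin d → Set UnitIco, (∀ i, IsHalfOpenInterval (I i)) ∧ R = Set.univ.pi I

/-- `f` coincides on `I` with a translation of the real line. -/
def IsIntervalTranslationOn (f : UnitIco → UnitIco) (I : Set UnitIco) : Prop :=
  ∃ v : ℝ, ∀ x ∈ I, (f x : ℝ) = (x : ℝ) + v

/-- `f` coincides on `R` with a translation of `ℝ^d`. -/
def IsTranslationOn {d : ℕ} (f : Cube d → Cube d) (R : Set (Cube d)) : Prop :=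
  ∃ v : Fin d → ℝ, ∀ x ∈ R, ∀ i, (f x i : ℝ) = (x i : ℝ) + v i

/-- `f` is an interval exchange: some finite partition of `[0,1[` into intervals `[a,b[` is
such that `f` is a translation on each piece. -/
def IsIntervalExchange (f : Equiv.Perm UnitIco) : Prop :=
  ∃ P : Set (Set UnitIco), P.Finite ∧ Setoid.IsPartition P ∧
    ∀ I ∈ P, IsHalfOpenInterval I ∧ IsIntervalTranslationOn f I

/-- `f` is a rectangle exchange: some finite partition of `[0,1[^d` into `d`-rectangles is
such that `f` is a translation on each piece. -/
def IsRectangleExchange {d : ℕ} (f : Equiv.Perm (Cube d)) : Prop :=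
  ∃ P : Set (Set (Cube d)), P.Finite ∧ Setoid.IsPartition P ∧
    ∀ R ∈ P, IsRectangle R ∧ IsTranslationOn f R

/-! Auxiliary facts: these maps form groups. -/

section Aux

theorem partition_one {X : Type*} [Nonempty X] :
    Setoid.IsPartition ({Set.univ} : Set (Set X)) := by
  refine ⟨fun h => ?_, fun a => ⟨Set.univ, ⟨rfl, trivial⟩, fun y hy => hy.1⟩⟩
  exact Set.empty_ne_univ (Set.mem_singleton_iff.1 h)

theorem partition_mul {X : Type*} (f : Equiv.Perm X) {P Q : Set (Set X)}
    (hPf : P.Finite) (hP : Setoid.IsPartition P) (hQf : Q.Finite) (hQ : Setoid.IsPartition Q) :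
    {C : Set X | C.Nonempty ∧ ∃ A ∈ P, ∃ B ∈ Q, C = A ∩ f ⁻¹' B}.Finite ∧
      Setoid.IsPartition {C : Set X | C.Nonempty ∧ ∃ A ∈ P, ∃ B ∈ Q, C = A ∩ f ⁻¹' B} := by
  refine ⟨?_, ?_, ?_⟩
  · refine (Set.Finite.image2 (fun A B => A ∩ f ⁻¹' B) hPf hQf).subset ?_
    rintro C ⟨-, A, hA, B, hB, rfl⟩
    exact ⟨A, hA, B, hB, rfl⟩
  · rintro ⟨h, -⟩
    exact Set.not_nonempty_empty h
  · intro x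
    obtain ⟨A, ⟨hA, hxA⟩, hAu⟩ := hP.2 x
    obtain ⟨B, ⟨hB, hxB⟩, hBu⟩ := hQ.2 (f x)
    refine ⟨A ∩ f ⁻¹' B, ⟨⟨⟨x, hxA, hxB⟩, A, hA, B, hB, rfl⟩, hxA, hxB⟩, ?_⟩
    rintro C ⟨⟨-, A', hA', B', hB', rfl⟩, hx1, hx2⟩
    rw [hAu A' ⟨hA', hx1⟩, hBu B' ⟨hB', hx2⟩]

theorem partition_inv {X : Type*} (f : Equiv.Perm X) {P : Set (Set X)}
    (hPf : P.Finite) (hP : Setoid.IsPartition P) :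
    ((fun A => f '' A) '' P).Finite ∧ Setoid.IsPartition ((fun A => f '' A) '' P) := by
  refine ⟨hPf.image _, ?_, ?_⟩
  · rintro ⟨A, hA, h⟩
    exact hP.1 (Set.image_eq_empty.1 h ▸ hA)
  · intro x
    obtain ⟨A, ⟨hA, hxA⟩, hAu⟩ := hP.2 (f.symm x)
    refine ⟨f '' A, ⟨⟨A, hA, rfl⟩, f.symm x, hxA, by simp⟩, ?_⟩
    rintro C ⟨⟨A', hA', rfl⟩, y, hy, rfl⟩
    rw [hAu A' ⟨hA', by simpa using hy⟩]

theorem interval_univ : IsHalfOpenInterval Set.univ :=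
  ⟨0, 1, le_rfl, one_pos, le_rfl, Set.ext fun x => ⟨fun _ => x.2, fun _ => trivial⟩⟩

theorem interval_nonempty {I : Set UnitIco} (h : IsHalfOpenInterval I) : I.Nonempty := by
  obtain ⟨a, b, ha, hab, hb, rfl⟩ := h
  exact ⟨⟨a, ha, hab.trans_le hb⟩, le_rfl, hab⟩

theorem interval_inter {I J : Set UnitIco} (hI : IsHalfOpenInterval I)
    (hJ : IsHalfOpenInterval J) (v : ℝ)
    (hne : {x : UnitIco | x ∈ I ∧ ∃ y ∈ J, (y : ℝ) = x + v}.Nonempty) :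
    IsHalfOpenInterval {x : UnitIco | x ∈ I ∧ ∃ y ∈ J, (y : ℝ) = x + v} := by
  obtain ⟨a, b, ha, hab, hb, rfl⟩ := hI
  obtain ⟨c, e, hc, hce, he, rfl⟩ := hJ
  obtain ⟨x, ⟨hx1, hx2⟩, y, ⟨hy1, hy2⟩, hy⟩ := hne
  refine ⟨max a (c - v), min b (e - v), ha.trans (le_max_left _ _), ?_,
    (min_le_left _ _).trans hb, ?_⟩
  · rw [max_lt_iff, lt_min_iff, lt_min_iff]
    refine ⟨⟨?_, ?_⟩, ?_, ?_⟩ <;> linarith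
  · ext z
    simp only [Set.mem_ofPred_eq, max_le_iff, lt_min_iff]
    constructor
    · rintro ⟨⟨h1, h2⟩, w, ⟨h3, h4⟩, hw⟩
      refine ⟨⟨h1, ?_⟩, h2, ?_⟩ <;> linarith
    · rintro ⟨⟨h1, h2⟩, h3, h4⟩
      refine ⟨⟨h1, h3⟩, ⟨(z : ℝ) + v, ?_, ?_⟩, ⟨?_, ?_⟩, rfl⟩ <;> (try simp only) <;> linarith

theorem interval_translate {I : Set UnitIco} (hI : IsHalfOpenInterval I) (v : ℝ)
    (h : ∀ x ∈ I, ∃ y : UnitIco, (y : ℝ) = x + v) :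
    IsHalfOpenInterval {y : UnitIco | ∃ x ∈ I, (y : ℝ) = x + v} := by
  obtain ⟨a, b, ha, hab, hb, rfl⟩ := hI
  refine ⟨a + v, b + v, ?_, by linarith, ?_, ?_⟩
  · obtain ⟨y, hy⟩ := h ⟨a, ha, hab.trans_le hb⟩ ⟨le_rfl, hab⟩
    simp only at hy
    rw [← hy]
    exact y.2.1
  · by_contra hcon
    have h1 : max a (1 - v) < b := max_lt hab (by linarith)
    obtain ⟨y, hy⟩ := h ⟨max a (1 - v), ha.trans (le_max_left _ _), h1.trans_le hb⟩
      ⟨le_max_left _ _, h1⟩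
    simp only at hy
    have h2 := y.2.2
    have h3 := le_max_right a (1 - v)
    linarith
  · ext y
    simp only [Set.mem_ofPred_eq]
    constructor
    · rintro ⟨x, ⟨h1, h2⟩, hy⟩
      constructor <;> linarith
    · rintro ⟨h1, h2⟩
      refine ⟨⟨(y : ℝ) - v, ?_, ?_⟩, ⟨?_, ?_⟩, ?_⟩ <;> (try simp only) <;> linarith

theorem interval_inter_preimage {f : UnitIco → UnitIco} {I J : Set UnitIco}
    (hI : IsHalfOpenInterval I) (hJ : IsHalfOpenInterval J) (hf : IsIntervalTranslationOn f I)
    (hne : (I ∩ f ⁻¹' J).Nonempty) : IsHalfOpenInterval (I ∩ f ⁻¹' J) := by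
  obtain ⟨v, hv⟩ := hf
  have key : I ∩ f ⁻¹' J = {x : UnitIco | x ∈ I ∧ ∃ y ∈ J, (y : ℝ) = x + v} := by
    ext x
    constructor
    · rintro ⟨h1, h2⟩
      exact ⟨h1, f x, h2, hv x h1⟩
    · rintro ⟨h1, y, h2, h3⟩
      refine ⟨h1, ?_⟩
      rwa [Set.mem_preimage, show f x = y from Subtype.ext ((hv x h1).trans h3.symm)]
  rw [key] at hne ⊢
  exact interval_inter hI hJ v hne

theorem interval_image {f : UnitIco → UnitIco} {I : Set UnitIco}
    (hI : IsHalfOpenInterval I) (hf : IsIntervalTranslationOn f I) :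
    IsHalfOpenInterval (f '' I) := by
  obtain ⟨v, hv⟩ := hf
  have key : f '' I = {y : UnitIco | ∃ x ∈ I, (y : ℝ) = x + v} := by
    ext y
    constructor
    · rintro ⟨x, h1, rfl⟩
      exact ⟨x, h1, hv x h1⟩
    · rintro ⟨x, h1, h2⟩
      exact ⟨x, h1, Subtype.ext ((hv x h1).trans h2.symm)⟩
  rw [key]
  exact interval_translate hI v fun x hx => ⟨f x, hv x hx⟩

theorem rectangle_inter_preimage {d : ℕ} {f : Cube d → Cube d} {A B : Set (Cube d)}
    (hA : IsRectangle A) (hB : IsRectangle B) (hf : IsTranslationOn f A)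
    (hne : (A ∩ f ⁻¹' B).Nonempty) : IsRectangle (A ∩ f ⁻¹' B) := by
  obtain ⟨I, hI, rfl⟩ := hA
  obtain ⟨J, hJ, rfl⟩ := hB
  obtain ⟨v, hv⟩ := hf
  have key : Set.univ.pi I ∩ f ⁻¹' Set.univ.pi J =
      Set.univ.pi fun i => {x : UnitIco | x ∈ I i ∧ ∃ y ∈ J i, (y : ℝ) = x + v i} := by
    ext x
    constructor
    · rintro ⟨h1, h2⟩ i -
      exact ⟨h1 i trivial, f x i, h2 i trivial, hv x h1 i⟩
    · intro h
      have h1 : x ∈ Set.univ.pi I := fun i _ => (h i trivial).1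
      refine ⟨h1, fun i _ => ?_⟩
      obtain ⟨-, y, h2, h3⟩ := h i trivial
      rwa [show f x i = y from Subtype.ext ((hv x h1 i).trans h3.symm)]
  rw [key] at hne ⊢
  obtain ⟨x, hx⟩ := hne
  exact ⟨_, fun i => interval_inter (hI i) (hJ i) (v i) ⟨x i, hx i trivial⟩, rfl⟩

theorem rectangle_image {d : ℕ} {f : Cube d → Cube d} {A : Set (Cube d)}
    (hA : IsRectangle A) (hf : IsTranslationOn f A) : IsRectangle (f '' A) := by
  obtain ⟨I, hI, rfl⟩ := hA
  obtain ⟨v, hv⟩ := hf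
  refine ⟨fun i => {y : UnitIco | ∃ x ∈ I i, (y : ℝ) = x + v i}, fun i => ?_, ?_⟩
  · refine interval_translate (hI i) (v i) fun x hx => ?_
    choose p hp using fun j => interval_nonempty (hI j)
    have hq : Function.update p i x ∈ Set.univ.pi I := by
      intro j _
      by_cases hj : j = i
      · subst hj
        simpa using hx
      · simpa [hj] using hp j
    exact ⟨f (Function.update p i x) i, by simpa using hv _ hq i⟩
  · ext y
    constructor
    · rintro ⟨x, hx, rfl⟩ i -
      exact ⟨x i, hx i trivial, hv x hx i⟩
    · intro h
      choose x hx hy using fun i => h i trivial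
      exact ⟨x, fun i _ => hx i,
        funext fun i => Subtype.ext ((hv x (fun i _ => hx i) i).trans (hy i).symm)⟩

end Aux

/-- The group `IET` of interval exchange transformations of `[0,1[`. -/
def IET : Subgroup (Equiv.Perm UnitIco) where
  carrier := {f | IsIntervalExchange f}
  one_mem' := by
    have : Nonempty UnitIco := ⟨⟨0, le_rfl, one_pos⟩⟩
    refine ⟨{Set.univ}, Set.finite_singleton _, partition_one, ?_⟩
    rintro I rfl
    exact ⟨interval_univ, 0, fun x _ => by simp⟩
  mul_mem' := by
    rintro f g ⟨P, hPf, hP, hPI⟩ ⟨Q, hQf, hQ, hQI⟩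
    obtain ⟨hf, hp⟩ := partition_mul g hQf hQ hPf hP
    refine ⟨_, hf, hp, ?_⟩
    rintro C ⟨hne, A, hA, B, hB, rfl⟩
    refine ⟨interval_inter_preimage (hQI A hA).1 (hPI B hB).1 (hQI A hA).2 hne, ?_⟩
    obtain ⟨v, hv⟩ := (hQI A hA).2
    obtain ⟨w, hw⟩ := (hPI B hB).2
    refine ⟨v + w, fun x hx => ?_⟩
    rw [Equiv.Perm.mul_apply, hw _ hx.2, hv _ hx.1, add_assoc]
  inv_mem' := by
    rintro f ⟨P, hPf, hP, hPI⟩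
    obtain ⟨hf, hp⟩ := partition_inv f hPf hP
    refine ⟨_, hf, hp, ?_⟩
    rintro C ⟨A, hA, rfl⟩
    refine ⟨interval_image (hPI A hA).1 (hPI A hA).2, ?_⟩
    obtain ⟨v, hv⟩ := (hPI A hA).2
    refine ⟨-v, ?_⟩
    rintro _ ⟨x, hx, rfl⟩
    rw [show f⁻¹ (f x) = x from f.symm_apply_apply x, hv x hx]
    ring

/-- The group `Rec_d` of rectangle exchange transformations of `[0,1[^d`. -/
def Rec (d : ℕ) : Subgroup (Equiv.Perm (Cube d)) where
  carrier := {f | IsRectangleExchange f}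
  one_mem' := by
    have : Nonempty (Cube d) := ⟨fun _ => ⟨0, le_rfl, one_pos⟩⟩
    refine ⟨{Set.univ}, Set.finite_singleton _, partition_one, ?_⟩
    rintro I rfl
    exact ⟨⟨fun _ => Set.univ, fun _ => interval_univ, by simp⟩, 0, fun x _ i => by simp⟩
  mul_mem' := by
    rintro f g ⟨P, hPf, hP, hPI⟩ ⟨Q, hQf, hQ, hQI⟩
    obtain ⟨hf, hp⟩ := partition_mul g hQf hQ hPf hP
    refine ⟨_, hf, hp, ?_⟩
    rintro C ⟨hne, A, hA, B, hB, rfl⟩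
    refine ⟨rectangle_inter_preimage (hQI A hA).1 (hPI B hB).1 (hQI A hA).2 hne, ?_⟩
    obtain ⟨v, hv⟩ := (hQI A hA).2
    obtain ⟨w, hw⟩ := (hPI B hB).2
    refine ⟨v + w, fun x hx i => ?_⟩
    rw [Equiv.Perm.mul_apply, hw _ hx.2, hv _ hx.1, add_assoc, Pi.add_apply]
  inv_mem' := by
    rintro f ⟨P, hPf, hP, hPI⟩
    obtain ⟨hf, hp⟩ := partition_inv f hPf hP
    refine ⟨_, hf, hp, ?_⟩
    rintro C ⟨A, hA, rfl⟩
    refine ⟨rectangle_image (hPI A hA).1 (hPI A hA).2, ?_⟩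
    obtain ⟨v, hv⟩ := (hPI A hA).2
    refine ⟨-v, ?_⟩
    rintro _ ⟨x, hx, rfl⟩ i
    rw [show f⁻¹ (f x) = x from f.symm_apply_apply x, hv x hx i, Pi.neg_apply]
    ring

/-- The image of `IET^d` in the permutations of `[0,1[^d`, acting coordinatewise:
`(s₁, …, s_d)` sends `(x₁, …, x_d)` to `(s₁ x₁, …, s_d x_d)`. -/
def coordinatewiseIET (d : ℕ) : Set (Equiv.Perm (Cube d)) :=
  {g | ∃ s : Fin d → Equiv.Perm UnitIco, (∀ i, s i ∈ IET) ∧ g = Equiv.piCongrRight s}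

/-- The set of rectangle transpositions: for disjoint rectangles `P`, `Q`, the permutation
exchanges `P` and `Q` by translations and is the identity outside `P ∪ Q`. -/
def rectangleTranspositions (d : ℕ) : Set (Equiv.Perm (Cube d)) :=
  {τ | ∃ P Q : Set (Cube d), IsRectangle P ∧ IsRectangle Q ∧ Disjoint P Q ∧
    τ '' P = Q ∧ τ '' Q = P ∧ IsTranslationOn τ P ∧ IsTranslationOn τ Q ∧
    ∀ x, x ∉ P ∪ Q → τ x = x}

/-- `GtG_d`: the group generated by `IET^d` and the rectangle transpositions. -/
def GtG (d : ℕ) : Subgroup (Equiv.Perm (Cube d)) :=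
  Subgroup.closure (coordinatewiseIET d ∪ rectangleTranspositions d)

/-- The derived subgroup `D(Rec_d)`, generated by the commutators of elements of `Rec_d`. -/
def derivedRec (d : ℕ) : Subgroup (Equiv.Perm (Cube d)) :=
  ⁅Rec d, Rec d⁆

end RectExchange

namespace RectExchange

/-! Let N be the subgroup generated by the involutions of `Rec d`; it is normalized by `Rec d`. An
involution permutes the pieces of a suitable rectangle partition, so it is a product of rectangle
transpositions, and N lies in `GtG d`. Everything about the upper inclusion follows from ⁅`Rec d`,
`Rec d`⁆ ≤ N, and normality of `GtG d` follows from its containing the derived subgroup.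

To see that `Rec d` is abelian modulo N, fix a coordinate i and show that `Rec d` is generated by N
and the maps supported in the half x_i < 1/2 (`rec_le_sup_recLow`). An involution exchanges the two
halves, so the other half serves as well. Maps with disjoint supports commute, hence so do any two
elements modulo N.

For the reduction to a half, tile [0,1[ in direction i by small tiles with lengths independent over
ℚ, such that every endpoint of a side of a piece of f, or of its image, is a tile boundary. Each
type of tile comes in two copies, used equally often between any two cuts. By independence,
intervals of equal length between cuts contain the same tiles up to order, so rearranging tiles
inside each piece makes f preserve types and positions in tiles. A further rearrangement puts all
first copies in the lower half and all second copies in the upper half; the conjugated map then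
preserves both halves and splits. An exchange of two adjacent small tiles lives in a thin slab,
which an involution moves into the lower half, so all rearrangements are harmless.

Strictness uses a Sah–Arnoux–Fathi type invariant: integrate a ℚ-linear function of the i-th
displacement against a product of finitely additive translation invariant functionals. This is a
homomorphism on `Rec d` killing commutators and rectangle transpositions. With ordinary length on
every side it detects an irrational rotation of one coordinate. If one other side is weighted by a
ℚ-linear γ with γ 1 = 0, it kills `IET^d` too, but not a rotation performed only over a slab of
irrational width. -/

variable {d : ℕ}

/-! ### Step functions on the cube. -/

/-- A function on the cube is a step function if it is constant on each piece of some finite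
partition into rectangles. -/
def IsStep {α : Type*} (φ : Cube d → α) : Prop :=
  ∃ P : Set (Set (Cube d)), P.Finite ∧ Setoid.IsPartition P ∧
    ∀ R ∈ P, IsRectangle R ∧ ∀ x ∈ R, ∀ y ∈ R, φ x = φ y

theorem IsStep.of_factor {α β : Type*} {φ : Cube d → α} {ψ : Cube d → β} (h : IsStep φ)
    (hf : ∀ x y, φ x = φ y → ψ x = ψ y) : IsStep ψ := by
  obtain ⟨P, hPf, hP, hR⟩ := h
  exact ⟨P, hPf, hP, fun R hRP => ⟨(hR R hRP).1, fun x hx y hy => hf _ _ ((hR R hRP).2 x hx y hy)⟩⟩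

/-- Membership in `Rec d` becomes a statement about step functions, which can be checked by
`IsStep.of_factor` from finitely many step data instead of by exhibiting a partition. -/
theorem mem_rec_iff {f : Equiv.Perm (Cube d)} :
    f ∈ Rec d ↔ IsStep (fun x j => (f x j : ℝ) - x j) := by
  constructor
  · rintro ⟨P, hPf, hP, hR⟩
    refine ⟨P, hPf, hP, fun R hRP => ⟨(hR R hRP).1, fun x hx y hy => ?_⟩⟩
    obtain ⟨v, hv⟩ := (hR R hRP).2
    funext j
    linarith [hv x hx j, hv y hy j]
  · rintro ⟨P, hPf, hP, hR⟩
    refine ⟨P, hPf, hP, fun R hRP => ⟨(hR R hRP).1, ?_⟩⟩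
    obtain ⟨x, hx⟩ : R.Nonempty := by
      rw [Set.nonempty_iff_ne_empty]
      rintro rfl
      exact hP.1 hRP
    refine ⟨fun j => (f x j : ℝ) - x j, fun y hy j => ?_⟩
    have := congrFun ((hR R hRP).2 x hx y hy) j
    simp only at this ⊢
    rw [this]
    ring

theorem IsStep.const {α : Type*} (c : α) : IsStep (fun _ : Cube d => c) :=
  (mem_rec_iff.1 (Rec d).one_mem).of_factor fun _ _ _ => rfl

theorem IsStep.comp_rec {α : Type*} {φ : Cube d → α} (h : IsStep φ) {f : Equiv.Perm (Cube d)}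
    (hf : f ∈ Rec d) : IsStep (fun x => φ (f x)) := by
  obtain ⟨P, hPf, hP, hPI⟩ := h
  obtain ⟨Q, hQf, hQ, hQI⟩ := hf
  obtain ⟨hf, hp⟩ := partition_mul f hQf hQ hPf hP
  refine ⟨_, hf, hp, ?_⟩
  rintro C ⟨hne, A, hA, B, hB, rfl⟩
  exact ⟨rectangle_inter_preimage (hQI A hA).1 (hPI B hB).1 (hQI A hA).2 hne,
    fun x hx y hy => (hPI B hB).2 _ hx.2 _ hy.2⟩

theorem IsStep.prodMk {α β : Type*} {φ : Cube d → α} {ψ : Cube d → β} (h : IsStep φ)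
    (h' : IsStep ψ) : IsStep (fun x => (φ x, ψ x)) := by
  obtain ⟨P, hPf, hP, hPI⟩ := h
  obtain ⟨Q, hQf, hQ, hQI⟩ := h'
  obtain ⟨hf, hp⟩ := partition_mul 1 hPf hP hQf hQ
  refine ⟨_, hf, hp, ?_⟩
  rintro C ⟨hne, A, hA, B, hB, rfl⟩
  refine ⟨rectangle_inter_preimage (hPI A hA).1 (hQI B hB).1 ⟨0, fun x _ i => by simp⟩ hne,
    fun x hx y hy => ?_⟩
  rw [Prod.mk.injEq]
  exact ⟨(hPI A hA).2 x hx.1 y hy.1, (hQI B hB).2 x hx.2 y hy.2⟩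

theorem IsStep.pi {ι α : Type*} [Finite ι] {φ : ι → Cube d → α} (h : ∀ i, IsStep (φ i)) :
    IsStep (fun x i => φ i x) := by
  classical
  cases nonempty_fintype ι
  -- The value `none` outside `s` keeps the index type fixed during the induction on `s`.
  have key : ∀ s : Finset ι, IsStep (fun x i => if i ∈ s then some (φ i x) else none) := by
    intro s
    induction s using Finset.induction_on with
    | empty => simpa using IsStep.const (d := d) (fun _ : ι => (none : Option α))
    | insert a s ha ih =>
      refine (ih.prodMk (h a)).of_factor fun x y hxy => ?_
      rw [Prod.mk.injEq] at hxy
      funext i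
      by_cases hi : i = a
      · subst hi
        simp [hxy.2]
      · have := congrFun hxy.1 i
        simpa [hi] using this
  refine (key Finset.univ).of_factor fun x y hxy => funext fun i => ?_
  simpa using congrFun hxy i

theorem IsStep.lt_const (i : Fin d) (c : ℝ) : IsStep (fun x : Cube d => (x i : ℝ) < c) := by
  classical
  -- Rectangles are nonempty, so the partition into two slabs is available only for 0 < c < 1;
  -- otherwise the condition is constant.
  rcases le_or_gt c 0 with hc | hc
  · refine (IsStep.const False).of_factor fun x y _ => ?_
    have hx := (x i).2.1
    have hy := (y i).2.1
    exact eq_iff_iff.2 (iff_of_false (not_lt.2 (hc.trans hx)) (not_lt.2 (hc.trans hy)))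
  rcases le_or_gt 1 c with hc' | hc'
  · refine (IsStep.const False).of_factor fun x y _ => ?_
    have hx := (x i).2.2
    have hy := (y i).2.2
    exact eq_iff_iff.2 (iff_of_true (hx.trans_le hc') (hy.trans_le hc'))
  have rect : ∀ J : Set UnitIco, IsHalfOpenInterval J → IsRectangle {x : Cube d | x i ∈ J} := by
    intro J hJ
    refine ⟨fun j => if j = i then J else Set.univ, fun j => ?_, ?_⟩
    · dsimp only
      split_ifs
      exacts [hJ, interval_univ]
    · ext x
      simp only [Set.mem_ofPred_eq, Set.mem_pi, Set.mem_univ, true_implies]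
      constructor
      · intro h j
        split_ifs with hj
        · rwa [hj]
        · trivial
      · intro h
        simpa using h i
  have h1 : IsHalfOpenInterval {t : UnitIco | 0 ≤ (t : ℝ) ∧ (t : ℝ) < c} :=
    ⟨0, c, le_rfl, hc, hc'.le, rfl⟩
  have h2 : IsHalfOpenInterval {t : UnitIco | c ≤ (t : ℝ) ∧ (t : ℝ) < 1} :=
    ⟨c, 1, hc.le, hc', le_rfl, rfl⟩
  have r1 := rect _ h1
  have r2 := rect _ h2
  have e1 : {x : Cube d | x i ∈ {t : UnitIco | 0 ≤ (t : ℝ) ∧ (t : ℝ) < c}} =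
      {x : Cube d | (x i : ℝ) < c} := by
    ext x
    exact ⟨fun h => h.2, fun h => ⟨(x i).2.1, h⟩⟩
  have e2 : {x : Cube d | x i ∈ {t : UnitIco | c ≤ (t : ℝ) ∧ (t : ℝ) < 1}} =
      {x : Cube d | c ≤ (x i : ℝ)} := by
    ext x
    exact ⟨fun h => h.1, fun h => ⟨h, (x i).2.2⟩⟩
  rw [e1] at r1
  rw [e2] at r2
  refine ⟨{{x | (x i : ℝ) < c}, {x | c ≤ (x i : ℝ)}}, by simp, ⟨?_, fun x => ?_⟩, ?_⟩
  · rintro (h | h)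
    · have : (fun _ => ⟨0, le_rfl, one_pos⟩ : Cube d) ∈ {x : Cube d | (x i : ℝ) < c} := hc
      rw [← h] at this
      exact this
    · have : (fun _ => ⟨c, hc.le, hc'⟩ : Cube d) ∈ {x : Cube d | c ≤ (x i : ℝ)} := le_refl c
      rw [← Set.mem_singleton_iff.1 h] at this
      exact this
  · rcases lt_or_ge (x i : ℝ) c with hx | hx
    · refine ⟨_, ⟨Or.inl rfl, hx⟩, ?_⟩
      rintro B ⟨rfl | rfl, hB⟩
      · rfl
      · exact absurd hx (not_lt.2 hB)
    · refine ⟨_, ⟨Or.inr rfl, hx⟩, ?_⟩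
      rintro B ⟨rfl | rfl, hB⟩
      · exact absurd hB (not_lt.2 hx)
      · rfl
  · rintro R (rfl | rfl)
    · exact ⟨r1, fun x hx y hy => eq_iff_iff.2 (iff_of_true hx hy)⟩
    · exact ⟨r2, fun x hx y hy => eq_iff_iff.2 (iff_of_false (not_lt.2 hx) (not_lt.2 hy))⟩

theorem IsStep.mem_interval {I : Set UnitIco} (hI : IsHalfOpenInterval I) (i : Fin d) :
    IsStep (fun x : Cube d => x i ∈ I) := by
  obtain ⟨a, b, -, -, -, rfl⟩ := hI
  refine ((IsStep.lt_const i a).prodMk (IsStep.lt_const i b)).of_factor fun x y h => ?_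
  simp only [Prod.mk.injEq, eq_iff_iff] at h
  simp only [Set.mem_ofPred_eq, ← not_lt, h.1, h.2]

theorem IsStep.mem_rectangle {R : Set (Cube d)} (hR : IsRectangle R) :
    IsStep (fun x : Cube d => x ∈ R) := by
  obtain ⟨I, hI, rfl⟩ := hR
  refine (IsStep.pi fun i => IsStep.mem_interval (hI i) i).of_factor fun x y h => ?_
  simp only [Set.mem_univ_pi, eq_iff_iff]
  exact forall_congr' fun i => eq_iff_iff.1 (congrFun h i)

theorem IsStep.of_cover {α : Type*} {φ : Cube d → α} {S : Set (Set (Cube d))} (hS : S.Finite)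
    (hstep : ∀ A ∈ S, IsStep (fun x => x ∈ A)) (hcov : ∀ x, ∃ A ∈ S, x ∈ A)
    (hφ : ∀ A ∈ S, ∀ x ∈ A, ∀ y ∈ A, φ x = φ y) : IsStep φ := by
  have : Finite S := hS
  refine (IsStep.pi fun A : S => hstep A A.2).of_factor fun x y h => ?_
  obtain ⟨A, hA, hx⟩ := hcov x
  exact hφ A hA x hx y ((eq_iff_iff.1 (congrFun h ⟨A, hA⟩)).1 hx)

theorem rectangleTransposition_mem_rec {τ : Equiv.Perm (Cube d)}
    (h : τ ∈ rectangleTranspositions d) : τ ∈ Rec d := by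
  obtain ⟨P, Q, hP, hQ, -, -, -, ⟨v, hv⟩, ⟨w, hw⟩, hfix⟩ := h
  have hstep := (IsStep.mem_rectangle hP).prodMk (IsStep.mem_rectangle hQ)
  refine mem_rec_iff.2 (hstep.of_factor fun x y h => ?_)
  simp only [Prod.mk.injEq, eq_iff_iff] at h
  funext j
  by_cases hxP : x ∈ P
  · rw [hv x hxP j, hv y (h.1.1 hxP) j]
    ring
  by_cases hxQ : x ∈ Q
  · rw [hw x hxQ j, hw y (h.2.1 hxQ) j]
    ring
  · rw [hfix x (by simp [hxP, hxQ]), hfix y (by simp [← h.1, ← h.2, hxP, hxQ])]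
    ring

theorem IsStep.displacement_of_mem_IET {s : Equiv.Perm UnitIco} (hs : s ∈ IET) (i : Fin d) :
    IsStep (fun x : Cube d => (s (x i) : ℝ) - x i) := by
  obtain ⟨P, hPf, hP, hPI⟩ := hs
  refine IsStep.of_cover (S := (fun I => {x : Cube d | x i ∈ I}) '' P) (hPf.image _) ?_ ?_ ?_
  · rintro _ ⟨I, hI, rfl⟩
    exact IsStep.mem_interval (hPI I hI).1 i
  · intro x
    obtain ⟨I, ⟨hI, hx⟩, -⟩ := hP.2 (x i)
    exact ⟨_, ⟨I, hI, rfl⟩, hx⟩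
  · rintro _ ⟨I, hI, rfl⟩ x hx y hy
    obtain ⟨v, hv⟩ := (hPI I hI).2
    rw [hv _ hx, hv _ hy]
    ring

theorem coordinatewiseIET_subset_rec : coordinatewiseIET d ⊆ Rec d := by
  rintro _ ⟨s, hs, rfl⟩
  refine mem_rec_iff.2 ?_
  exact IsStep.pi fun i => IsStep.displacement_of_mem_IET (hs i) i

theorem GtG_le_rec : GtG d ≤ Rec d := by
  rw [GtG, Subgroup.closure_le]
  exact Set.union_subset coordinatewiseIET_subset_rec fun _ => rectangleTransposition_mem_rec


/-! ### Involutions are products of rectangle transpositions. -/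

open Classical in
/-- The permutation that agrees with `σ` on the invariant set `U` and is the identity elsewhere. -/
noncomputable def restrictPerm {X : Type*} (σ : Equiv.Perm X) (U : Set X)
    (h : ∀ x, σ x ∈ U ↔ x ∈ U) : Equiv.Perm X where
  toFun x := if x ∈ U then σ x else x
  invFun x := if x ∈ U then σ⁻¹ x else x
  left_inv x := by
    by_cases hx : x ∈ U
    · simp [hx, (h x).2 hx]
    · simp [hx]
  right_inv x := by
    by_cases hx : x ∈ U
    · have : σ⁻¹ x ∈ U := by simpa [hx] using h (σ⁻¹ x)
      simp only [if_pos hx, if_pos this]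
      exact σ.apply_symm_apply x
    · simp [hx]

theorem restrictPerm_apply_of_mem {X : Type*} {σ : Equiv.Perm X} {U : Set X}
    (h : ∀ x, σ x ∈ U ↔ x ∈ U) {x : X} (hx : x ∈ U) : restrictPerm σ U h x = σ x :=
  if_pos hx

theorem restrictPerm_apply_of_notMem {X : Type*} {σ : Equiv.Perm X} {U : Set X}
    (h : ∀ x, σ x ∈ U ↔ x ∈ U) {x : X} (hx : x ∉ U) : restrictPerm σ U h x = x :=
  if_neg hx

theorem restrictPerm_mem_rec {σ : Equiv.Perm (Cube d)} (hσ : σ ∈ Rec d) {U : Set (Cube d)}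
    (h : ∀ x, σ x ∈ U ↔ x ∈ U) (hU : IsStep (fun x => x ∈ U)) : restrictPerm σ U h ∈ Rec d := by
  refine mem_rec_iff.2 ((hU.prodMk (mem_rec_iff.1 hσ)).of_factor fun x y hxy => ?_)
  rw [Prod.mk.injEq, eq_iff_iff] at hxy
  by_cases hx : x ∈ U
  · rw [restrictPerm_apply_of_mem h hx, restrictPerm_apply_of_mem h (hxy.1.1 hx)]
    exact hxy.2
  · rw [restrictPerm_apply_of_notMem h hx, restrictPerm_apply_of_notMem h fun hy => hx (hxy.1.2 hy)]
    simp

theorem partition_eq_of_mem {X : Type*} {P : Set (Set X)} (hP : Setoid.IsPartition P)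
    {A B : Set X} (hA : A ∈ P) (hB : B ∈ P) {x : X} (hxA : x ∈ A) (hxB : x ∈ B) : A = B :=
  (hP.2 x).unique ⟨hA, hxA⟩ ⟨hB, hxB⟩

/-- If R met its image, the two pieces would coincide; then σ would be the translation by v twice on
an orbit in R, and σ² = 1 would force v = 0. -/
theorem IsTranslationOn.disjoint_of_involutive {σ : Equiv.Perm (Cube d)} (h2 : ∀ x, σ (σ x) = x)
    {P : Set (Set (Cube d))} (hP : Setoid.IsPartition P) {R : Set (Cube d)} (hR : R ∈ P)
    (hσR : σ '' R ∈ P) (ht : IsTranslationOn σ R) {x : Cube d} (hx : x ∈ R) (hne : σ x ≠ x) :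
    Disjoint R (σ '' R) := by
  rw [Set.disjoint_left]
  intro y hy hy'
  obtain ⟨v, hv⟩ := ht
  have hσx : σ x ∈ R := by
    rw [partition_eq_of_mem hP hR hσR hy hy']
    exact ⟨x, hx, rfl⟩
  refine hne (funext fun i => Subtype.ext ?_)
  have h1 := hv x hx i
  have h3 := hv _ hσx i
  rw [h2] at h3
  linarith

/-- Induction on the number of pieces that are not fixed pointwise. The restriction τ of σ to a
moved piece and its image is a rectangle transposition, and σ τ is again an involution permuting the
pieces, with fewer of them moved. -/
theorem mem_closure_rectangleTranspositions_aux {P : Set (Set (Cube d))} (hPf : P.Finite)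
    (hP : Setoid.IsPartition P) (hPR : ∀ R ∈ P, IsRectangle R) (n : ℕ) :
    ∀ σ : Equiv.Perm (Cube d), (∀ x, σ (σ x) = x) → (∀ R ∈ P, IsTranslationOn σ R) →
      (∀ R ∈ P, σ '' R ∈ P) → {R ∈ P | ∃ x ∈ R, σ x ≠ x}.ncard < n →
      σ ∈ Subgroup.closure (rectangleTranspositions d) := by
  induction n with
  | zero => exact fun σ _ _ _ h => absurd h (Nat.not_lt_zero _)
  | succ n ih =>
    intro σ h2 ht him hn
    by_cases hall : ∀ x, σ x = x
    · rw [show σ = 1 from Equiv.ext hall]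
      exact one_mem _
    push Not at hall
    obtain ⟨x, hx⟩ := hall
    obtain ⟨R, ⟨hR, hxR⟩, -⟩ := hP.2 x
    have hdisj := IsTranslationOn.disjoint_of_involutive h2 hP hR (him R hR) (ht R hR) hxR hx
    have himim : σ '' (σ '' R) = R := by
      rw [← Set.image_comp, show σ ∘ σ = id from funext h2, Set.image_id]
    have hinv' : ∀ y ∈ R ∪ σ '' R, σ y ∈ R ∪ σ '' R := by
      rintro y (hy | ⟨z, hz, rfl⟩)
      · exact Or.inr ⟨y, hy, rfl⟩
      · rw [h2]
        exact Or.inl hz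
    have hinv : ∀ y, σ y ∈ R ∪ σ '' R ↔ y ∈ R ∪ σ '' R :=
      fun y => ⟨fun hy => h2 y ▸ hinv' _ hy, hinv' y⟩
    set τ := restrictPerm σ _ hinv with hτ
    have hτR : Set.EqOn τ σ R := fun y hy => restrictPerm_apply_of_mem hinv (Or.inl hy)
    have hτR' : Set.EqOn τ σ (σ '' R) := fun y hy => restrictPerm_apply_of_mem hinv (Or.inr hy)
    have hτmem : τ ∈ rectangleTranspositions d := by
      refine ⟨R, σ '' R, hPR R hR, hPR _ (him R hR), hdisj, hτR.image_eq, ?_, ?_, ?_, ?_⟩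
      · rw [hτR'.image_eq, himim]
      · obtain ⟨v, hv⟩ := ht R hR
        exact ⟨v, fun y hy => by rw [hτR hy]; exact hv y hy⟩
      · obtain ⟨v, hv⟩ := ht _ (him R hR)
        exact ⟨v, fun y hy => by rw [hτR' hy]; exact hv y hy⟩
      · exact fun y hy => restrictPerm_apply_of_notMem hinv hy
    have happ1 : ∀ y ∈ R ∪ σ '' R, (σ * τ) y = y := fun y hy => by
      rw [Equiv.Perm.mul_apply, hτ, restrictPerm_apply_of_mem hinv hy, h2]
    have happ2 : ∀ y ∉ R ∪ σ '' R, (σ * τ) y = σ y := fun y hy => by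
      rw [Equiv.Perm.mul_apply, hτ, restrictPerm_apply_of_notMem hinv hy]
    have hcase : ∀ A ∈ P, (∀ y ∈ A, (σ * τ) y = y) ∨ Set.EqOn (σ * τ) σ A := by
      intro A hA
      by_cases hAR : ∃ y ∈ A, y ∈ R ∪ σ '' R
      · left
        obtain ⟨y, hy, hy'⟩ := hAR
        intro z hz
        refine happ1 z ?_
        rcases hy' with hy' | hy'
        · exact Or.inl (partition_eq_of_mem hP hA hR hy hy' ▸ hz)
        · exact Or.inr (partition_eq_of_mem hP hA (him R hR) hy hy' ▸ hz)
      · exact Or.inr fun y hy => happ2 y fun hy' => hAR ⟨y, hy, hy'⟩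
    have hmem : σ * τ ∈ Subgroup.closure (rectangleTranspositions d) := by
      refine ih (σ * τ) (fun y => ?_) (fun A hA => ?_) (fun A hA => ?_) ?_
      · by_cases hy : y ∈ R ∪ σ '' R
        · rw [happ1 y hy, happ1 y hy]
        · rw [happ2 y hy, happ2 _ (fun h => hy ((hinv y).1 h)), h2]
      · rcases hcase A hA with h | h
        · exact ⟨0, fun y hy i => by rw [h y hy]; simp⟩
        · obtain ⟨v, hv⟩ := ht A hA
          exact ⟨v, fun y hy => by rw [h hy]; exact hv y hy⟩
      · rcases hcase A hA with h | h
        · rw [show (σ * τ) '' A = A by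
            rw [Set.EqOn.image_eq (f₂ := id) fun y hy => h y hy, Set.image_id]]
          exact hA
        · rw [h.image_eq]
          exact him A hA
      · refine lt_of_lt_of_le (Set.ncard_lt_ncard ?_ (hPf.subset (Set.sep_subset _ _)))
          (Nat.lt_succ_iff.1 hn)
        refine ⟨?_, fun hsub => ?_⟩
        · rintro A ⟨hA, y, hy, hne⟩
          refine ⟨hA, y, hy, ?_⟩
          by_cases hy' : y ∈ R ∪ σ '' R
          · exact absurd (happ1 y hy') hne
          · rwa [happ2 y hy'] at hne
        · obtain ⟨-, y, hy, hne⟩ := hsub ⟨hR, x, hxR, hx⟩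
          exact hne (happ1 y (Or.inl hy))
    have : σ = (σ * τ) * τ⁻¹ := by group
    rw [this]
    exact mul_mem hmem (inv_mem (Subgroup.subset_closure hτmem))

/-- An involution in `Rec_d` is a product of rectangle transpositions. -/
theorem mem_closure_rectangleTranspositions {σ : Equiv.Perm (Cube d)} (hσ : σ ∈ Rec d)
    (h2 : ∀ x, σ (σ x) = x) : σ ∈ Subgroup.closure (rectangleTranspositions d) := by
  obtain ⟨P, hPf, hP, hPI⟩ := hσ
  -- The pieces A ∩ σ⁻¹ B are permuted by σ: since σ² = 1, the image of A ∩ σ⁻¹ B is B ∩ σ⁻¹ A.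
  obtain ⟨hf, hp⟩ := partition_mul σ hPf hP hPf hP
  refine mem_closure_rectangleTranspositions_aux hf hp ?_ _ σ h2 ?_ ?_ (Nat.lt_succ_self _)
  · rintro C ⟨hne, A, hA, B, hB, rfl⟩
    exact rectangle_inter_preimage (hPI A hA).1 (hPI B hB).1 (hPI A hA).2 hne
  · rintro C ⟨hne, A, hA, B, hB, rfl⟩
    obtain ⟨v, hv⟩ := (hPI A hA).2
    exact ⟨v, fun x hx => hv x hx.1⟩
  · rintro C ⟨hne, A, hA, B, hB, rfl⟩
    refine ⟨hne.image _, B, hB, A, hA, ?_⟩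
    ext y
    constructor
    · rintro ⟨x, ⟨hxA, hxB⟩, rfl⟩
      exact ⟨hxB, by rwa [Set.mem_preimage, h2]⟩
    · rintro ⟨hyB, hyA⟩
      exact ⟨σ y, ⟨hyA, by rwa [Set.mem_preimage, h2]⟩, h2 y⟩

/-- The subgroup generated by the involutions of `Rec_d`. -/
def involutionSubgroup (d : ℕ) : Subgroup (Equiv.Perm (Cube d)) :=
  Subgroup.closure {σ | σ ∈ Rec d ∧ ∀ x, σ (σ x) = x}

theorem involutionSubgroup_le_rec : involutionSubgroup d ≤ Rec d :=
  (Subgroup.closure_le _).2 fun _ h => h.1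

theorem involutionSubgroup_le_closure :
    involutionSubgroup d ≤ Subgroup.closure (rectangleTranspositions d) :=
  (Subgroup.closure_le _).2 fun _ h => mem_closure_rectangleTranspositions h.1 h.2

theorem conj_mem_involutionSubgroup {r n : Equiv.Perm (Cube d)} (hr : r ∈ Rec d)
    (hn : n ∈ involutionSubgroup d) : r * n * r⁻¹ ∈ involutionSubgroup d := by
  refine Subgroup.closure_induction (p := fun n _ => r * n * r⁻¹ ∈ involutionSubgroup d)
    (fun σ hσ => Subgroup.subset_closure ⟨mul_mem (mul_mem hr hσ.1) (inv_mem hr), fun x => ?_⟩)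
    ?_ (fun a b _ _ ha hb => ?_) (fun a _ ha => ?_) hn
  · simp [Equiv.Perm.mul_apply, hσ.2]
  · simp
  · rw [show r * (a * b) * r⁻¹ = (r * a * r⁻¹) * (r * b * r⁻¹) by group]
    exact mul_mem ha hb
  · rw [show r * a⁻¹ * r⁻¹ = (r * a * r⁻¹)⁻¹ by group]
    exact inv_mem ha

/-! ### A criterion for an abelian quotient. -/

open scoped commutatorElement in
-- For fixed g, the f that commute with g modulo the normalized subgroup N form a subgroup; it
-- contains N and A, hence all of R.
theorem commutator_mem_of_le_sup {G : Type*} [Group G] {N A R : Subgroup G} (hNR : N ≤ R)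
    (hnorm : ∀ r ∈ R, ∀ n ∈ N, r * n * r⁻¹ ∈ N) (hA : A ≤ R) (hRA : R ≤ N ⊔ A) {g : G}
    (hg : g ∈ R) (hAg : ∀ a ∈ A, ⁅a, g⁆ ∈ N) {f : G} (hf : f ∈ R) : ⁅f, g⁆ ∈ N := by
  let C : Subgroup G :=
    { carrier := {f | f ∈ R ∧ ⁅f, g⁆ ∈ N}
      one_mem' := ⟨one_mem _, by simp⟩
      mul_mem' := by
        rintro a b ⟨ha, ha'⟩ ⟨hb, hb'⟩
        refine ⟨mul_mem ha hb, ?_⟩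
        rw [show ⁅a * b, g⁆ = a * ⁅b, g⁆ * a⁻¹ * ⁅a, g⁆ by simp only [commutatorElement_def]; group]
        exact mul_mem (hnorm a ha _ hb') ha'
      inv_mem' := by
        rintro a ⟨ha, ha'⟩
        refine ⟨inv_mem ha, ?_⟩
        rw [show ⁅a⁻¹, g⁆ = a⁻¹ * ⁅a, g⁆⁻¹ * a⁻¹⁻¹ by simp only [commutatorElement_def]; group]
        exact hnorm _ (inv_mem ha) _ (inv_mem ha') }
  have hle : N ⊔ A ≤ C := by
    refine sup_le (fun n hn => ⟨hNR hn, ?_⟩) fun a ha => ⟨hA ha, hAg a ha⟩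
    rw [show ⁅n, g⁆ = n * (g * n⁻¹ * g⁻¹) by simp only [commutatorElement_def]; group]
    exact mul_mem hn (hnorm g hg _ (inv_mem hn))
  exact (hle (hRA hf)).2

-- Modulo N, every element has a representative in A and another one in B. Using the first for one
-- argument of a commutator and the second for the other makes it trivial.
open scoped commutatorElement in
theorem commutator_le_of_le_sup {G : Type*} [Group G] {N A B R : Subgroup G} (hNR : N ≤ R)
    (hnorm : ∀ r ∈ R, ∀ n ∈ N, r * n * r⁻¹ ∈ N) (hA : A ≤ R) (hB : B ≤ R) (hRA : R ≤ N ⊔ A)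
    (hRB : R ≤ N ⊔ B) (hcomm : ∀ a ∈ A, ∀ b ∈ B, Commute a b) : ⁅R, R⁆ ≤ N := by
  rw [Subgroup.commutator_le]
  intro f hf g hg
  refine commutator_mem_of_le_sup hNR hnorm hA hRA hg (fun a ha => ?_) hf
  rw [← commutatorElement_inv]
  refine inv_mem (commutator_mem_of_le_sup hNR hnorm hB hRB (hA ha) (fun b hb => ?_) hg)
  rw [commutatorElement_eq_one_iff_commute.2 (hcomm a ha b hb).symm]
  exact one_mem _


/-! ### Interval exchanges along one coordinate, and maps supported in half of the cube. -/

open Classical in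
/-- The permutations of `[0,1[` act on the `i`-th coordinate of the points of the cube whose other
coordinates are subject to a condition, given by `B`. -/
noncomputable def fiberPerm (i : Fin d) (B : Set (Cube d)) :
    Equiv.Perm UnitIco →* Equiv.Perm (Cube d) where
  toFun s :=
    -- Resetting coordinate i before testing membership makes the condition independent of that
    -- coordinate, hence invariant under the action.
    { toFun := fun x => if Function.update x i 0 ∈ B then Function.update x i (s (x i)) else x
      invFun := fun x => if Function.update x i 0 ∈ B then Function.update x i (s⁻¹ (x i)) else x
      left_inv := fun x => by
        by_cases hx : Function.update x i 0 ∈ B <;> simp [hx]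
      right_inv := fun x => by
        by_cases hx : Function.update x i 0 ∈ B <;> simp [hx] }
  map_one' := by
    ext x : 1
    simp
  map_mul' s t := by
    ext x : 1
    by_cases hx : Function.update x i 0 ∈ B <;> simp [hx]

theorem fiberPerm_apply_of_mem {i : Fin d} {B : Set (Cube d)} (s : Equiv.Perm UnitIco) {x : Cube d}
    (hx : Function.update x i 0 ∈ B) : fiberPerm i B s x = Function.update x i (s (x i)) :=
  if_pos hx

theorem fiberPerm_apply_of_notMem {i : Fin d} {B : Set (Cube d)} (s : Equiv.Perm UnitIco)
    {x : Cube d} (hx : Function.update x i 0 ∉ B) : fiberPerm i B s x = x :=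
  if_neg hx

theorem fiberPerm_univ_apply {i : Fin d} (s : Equiv.Perm UnitIco) (x : Cube d) :
    fiberPerm i Set.univ s x = Function.update x i (s (x i)) :=
  if_pos trivial

theorem fiberPerm_mem_rec {i : Fin d} {B : Set (Cube d)} {s : Equiv.Perm UnitIco}
    (hs : IsStep (fun x : Cube d => (s (x i) : ℝ) - x i))
    (hB : IsStep (fun x : Cube d => Function.update x i 0 ∈ B)) : fiberPerm i B s ∈ Rec d := by
  refine mem_rec_iff.2 ((hs.prodMk hB).of_factor fun x y h => ?_)
  simp only [Prod.mk.injEq, eq_iff_iff] at h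
  funext j
  by_cases hx : Function.update x i 0 ∈ B
  · rw [fiberPerm_apply_of_mem s hx, fiberPerm_apply_of_mem s (h.2.1 hx)]
    by_cases hj : j = i
    · subst hj
      simpa using h.1
    · simp [hj]
  · rw [fiberPerm_apply_of_notMem s hx, fiberPerm_apply_of_notMem s fun hy => hx (h.2.2 hy)]
    simp

/-- The permutation of `[0,1[` induced by mutually inverse real functions. -/
def unitPerm (f g : ℝ → ℝ) (hf : ∀ t ∈ Set.Ico (0 : ℝ) 1, f t ∈ Set.Ico (0 : ℝ) 1 ∧ g (f t) = t)
    (hg : ∀ t ∈ Set.Ico (0 : ℝ) 1, g t ∈ Set.Ico (0 : ℝ) 1 ∧ f (g t) = t) :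
    Equiv.Perm UnitIco where
  toFun t := ⟨f t, (hf t t.2).1⟩
  invFun t := ⟨g t, (hg t t.2).1⟩
  left_inv t := Subtype.ext (hf t t.2).2
  right_inv t := Subtype.ext (hg t t.2).2

/-- The exchange of the consecutive intervals `[c,c+p[` and `[c+p,c+p+q[`, on the real line. -/
noncomputable def rotFun (c p q t : ℝ) : ℝ :=
  if t < c then t else if t < c + p then t + q else if t < c + p + q then t - p else t

theorem rotFun_spec {c p q : ℝ} (hc : 0 ≤ c) (hp : 0 ≤ p) (hq : 0 ≤ q) (h : c + p + q ≤ 1) :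
    ∀ t ∈ Set.Ico (0 : ℝ) 1, rotFun c p q t ∈ Set.Ico (0 : ℝ) 1 ∧
      rotFun c q p (rotFun c p q t) = t := by
  rintro t ⟨h0, h1⟩
  unfold rotFun
  constructor
  · constructor <;> split_ifs <;> linarith
  · split_ifs <;> linarith

/-- The interval exchange that exchanges `[c,c+p[` and `[c+p,c+p+q[`. -/
noncomputable def rot (c p q : ℝ) (hc : 0 ≤ c) (hp : 0 ≤ p) (hq : 0 ≤ q) (h : c + p + q ≤ 1) :
    Equiv.Perm UnitIco :=
  unitPerm (rotFun c p q) (rotFun c q p) (rotFun_spec hc hp hq h)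
    (rotFun_spec hc hq hp (by linarith))

theorem isStep_rot (i : Fin d) {c p q : ℝ} (hc : 0 ≤ c) (hp : 0 ≤ p) (hq : 0 ≤ q)
    (h : c + p + q ≤ 1) :
    IsStep (fun x : Cube d => (rot c p q hc hp hq h (x i) : ℝ) - x i) := by
  refine ((IsStep.lt_const i c).prodMk ((IsStep.lt_const i (c + p)).prodMk
    (IsStep.lt_const i (c + p + q)))).of_factor fun x y hxy => ?_
  simp only [Prod.mk.injEq, eq_iff_iff] at hxy
  change rotFun c p q (x i) - x i = rotFun c p q (y i) - y i
  simp only [rotFun, hxy.1, hxy.2.1, hxy.2.2]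
  split_ifs <;> ring

/-- The exchange of the intervals `[0,l[` and `[a,a+l[`, on the real line. -/
noncomputable def swapFun (a l t : ℝ) : ℝ :=
  if t < l then t + a else if t < a then t else if t < a + l then t - a else t

theorem swapFun_spec {a l : ℝ} (hl : 0 ≤ l) (hla : l ≤ a) (h : a + l ≤ 1) :
    ∀ t ∈ Set.Ico (0 : ℝ) 1, swapFun a l t ∈ Set.Ico (0 : ℝ) 1 ∧
      swapFun a l (swapFun a l t) = t := by
  rintro t ⟨h0, h1⟩
  unfold swapFun
  constructor
  · constructor <;> split_ifs <;> linarith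
  · split_ifs <;> linarith

/-- The interval exchange that exchanges `[0,l[` and `[a,a+l[`. -/
noncomputable def intervalSwap (a l : ℝ) (hl : 0 ≤ l) (hla : l ≤ a) (h : a + l ≤ 1) :
    Equiv.Perm UnitIco :=
  unitPerm (swapFun a l) (swapFun a l) (swapFun_spec hl hla h) (swapFun_spec hl hla h)

theorem isStep_intervalSwap (i : Fin d) {a l : ℝ} (hl : 0 ≤ l) (hla : l ≤ a) (h : a + l ≤ 1) :
    IsStep (fun x : Cube d => (intervalSwap a l hl hla h (x i) : ℝ) - x i) := by
  refine ((IsStep.lt_const i l).prodMk ((IsStep.lt_const i a).prodMk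
    (IsStep.lt_const i (a + l)))).of_factor fun x y hxy => ?_
  simp only [Prod.mk.injEq, eq_iff_iff] at hxy
  change swapFun a l (x i) - x i = swapFun a l (y i) - y i
  simp only [swapFun, hxy.1, hxy.2.1, hxy.2.2]
  split_ifs <;> ring

theorem fiberPerm_intervalSwap_mem (i : Fin d) {a l : ℝ} (hl : 0 ≤ l) (hla : l ≤ a)
    (h : a + l ≤ 1) :
    fiberPerm i Set.univ (intervalSwap a l hl hla h) ∈ involutionSubgroup d := by
  refine Subgroup.subset_closure ⟨fiberPerm_mem_rec (isStep_intervalSwap i hl hla h)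
    ((IsStep.const True).of_factor fun x y _ => by simp), fun x => ?_⟩
  rw [fiberPerm_univ_apply, fiberPerm_univ_apply]
  simp only [Function.update_self, Function.update_idem]
  rw [show intervalSwap a l hl hla h (intervalSwap a l hl hla h (x i)) = x i from
    Subtype.ext (swapFun_spec hl hla h _ (x i).2).2, Function.update_eq_self]

/-- The rectangle exchanges supported in `U`. -/
def recSupportedIn (U : Set (Cube d)) : Subgroup (Equiv.Perm (Cube d)) where
  carrier := {f | f ∈ Rec d ∧ ∀ x ∉ U, f x = x}
  one_mem' := ⟨one_mem _, fun _ _ => rfl⟩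
  mul_mem' := fun {f g} hf hg => ⟨mul_mem hf.1 hg.1, fun x hx => by
    rw [Equiv.Perm.mul_apply, hg.2 x hx, hf.2 x hx]⟩
  inv_mem' := fun {f} hf => ⟨inv_mem hf.1, fun x hx => by
    rw [Equiv.Perm.inv_eq_iff_eq, hf.2 x hx]⟩

/-- The rectangle exchanges supported where the `i`-th coordinate is less than `1/2`. -/
def recLow (i : Fin d) : Subgroup (Equiv.Perm (Cube d)) :=
  recSupportedIn {x | (x i : ℝ) < 1 / 2}

/-- The rectangle exchanges supported where the `i`-th coordinate is at least `1/2`. -/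
def recHigh (i : Fin d) : Subgroup (Equiv.Perm (Cube d)) :=
  recSupportedIn {x | 1 / 2 ≤ (x i : ℝ)}

theorem commute_of_mem_recLow_recHigh {i : Fin d} {f g : Equiv.Perm (Cube d)} (hf : f ∈ recLow i)
    (hg : g ∈ recHigh i) : Commute f g := by
  refine Equiv.Perm.Disjoint.commute fun x => ?_
  rcases lt_or_ge (x i : ℝ) (1 / 2) with h | h
  · exact Or.inr (hg.2 x (not_le.2 h))
  · exact Or.inl (hf.2 x (not_lt.2 h))

theorem conj_mem_recSupportedIn {U V : Set (Cube d)} {f τ : Equiv.Perm (Cube d)}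
    (hf : f ∈ recSupportedIn U) (hτ : τ ∈ Rec d) (h : ∀ x, x ∉ V → τ⁻¹ x ∉ U) :
    τ * f * τ⁻¹ ∈ recSupportedIn V := by
  refine ⟨mul_mem (mul_mem hτ hf.1) (inv_mem hτ), fun x hx => ?_⟩
  rw [Equiv.Perm.mul_apply, Equiv.Perm.mul_apply, hf.2 _ (h x hx)]
  exact τ.apply_symm_apply x

theorem mem_sup_of_conj {G : Type*} [Group G] {N A : Subgroup G} {τ f : G} (hτ : τ ∈ N)
    (h : τ * f * τ⁻¹ ∈ A) : f ∈ N ⊔ A := by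
  rw [show f = τ⁻¹ * (τ * f * τ⁻¹) * τ by group]
  exact mul_mem (mul_mem (inv_mem (le_sup_left (a := N) hτ)) (le_sup_right (a := N) h))
    (le_sup_left (a := N) hτ)

theorem intervalSwap_inv {a l : ℝ} (hl : 0 ≤ l) (hla : l ≤ a) (h : a + l ≤ 1) :
    (intervalSwap a l hl hla h)⁻¹ = intervalSwap a l hl hla h :=
  rfl

/-- A slab that starts below 1/4 already lies in the lower half. Otherwise l ≤ 1/4 ≤ a, so the slab
is disjoint from [0,l[ and the involution exchanging the two conjugates f into `recLow i`. -/
theorem mem_sup_recLow_of_slab {i : Fin d} {a l : ℝ} (hl : 0 ≤ l) (hl' : l ≤ 1 / 4)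
    (hal : a + l ≤ 1) {f : Equiv.Perm (Cube d)}
    (hf : f ∈ recSupportedIn {x | a ≤ (x i : ℝ) ∧ (x i : ℝ) < a + l}) :
    f ∈ involutionSubgroup d ⊔ recLow i := by
  rcases lt_or_ge a (1 / 4) with h | h
  · refine le_sup_right (a := involutionSubgroup d) (⟨hf.1, fun x hx => hf.2 x fun hx' => hx ?_⟩)
    have := hx'.2
    change (x i : ℝ) < 1 / 2
    linarith
  · have hτ := fiberPerm_intervalSwap_mem i hl (hl'.trans h) hal
    refine mem_sup_of_conj hτ (conj_mem_recSupportedIn hf (involutionSubgroup_le_rec hτ) ?_)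
    intro x hx hx'
    rw [← map_inv, intervalSwap_inv, fiberPerm_univ_apply] at hx'
    simp only [Set.mem_ofPred_eq, Function.update_self] at hx hx'
    change a ≤ swapFun a l (x i) ∧ swapFun a l (x i) < a + l at hx'
    have h0 := (x i).2.1
    unfold swapFun at hx'
    split_ifs at hx' <;> linarith [hx'.1, hx'.2]

theorem recHigh_le_sup_recLow (i : Fin d) : recHigh i ≤ involutionSubgroup d ⊔ recLow i := by
  intro f hf
  -- The involution that exchanges the two halves of the cube.
  have hτ := fiberPerm_intervalSwap_mem i (a := 1 / 2) (l := 1 / 2) (by norm_num) le_rfl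
    (by norm_num)
  refine mem_sup_of_conj hτ (conj_mem_recSupportedIn hf (involutionSubgroup_le_rec hτ) ?_)
  intro x hx hx'
  rw [← map_inv, intervalSwap_inv, fiberPerm_univ_apply] at hx'
  simp only [Set.mem_ofPred_eq, Function.update_self] at hx hx'
  change 1 / 2 ≤ swapFun (1 / 2) (1 / 2) (x i) at hx'
  have h0 := (x i).2.2
  unfold swapFun at hx'
  split_ifs at hx' <;> linarith

theorem recLow_le_sup_recHigh (i : Fin d) : recLow i ≤ involutionSubgroup d ⊔ recHigh i := by
  intro f hf
  have hτ := fiberPerm_intervalSwap_mem i (a := 1 / 2) (l := 1 / 2) (by norm_num) le_rfl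
    (by norm_num)
  refine mem_sup_of_conj hτ (conj_mem_recSupportedIn hf (involutionSubgroup_le_rec hτ) ?_)
  intro x hx hx'
  rw [← map_inv, intervalSwap_inv, fiberPerm_univ_apply] at hx'
  simp only [Set.mem_ofPred_eq, Function.update_self] at hx hx'
  change swapFun (1 / 2) (1 / 2) (x i) < 1 / 2 at hx'
  have h0 := (x i).2.1
  unfold swapFun at hx'
  split_ifs at hx' <;> linarith

/-- The permutations of `[0,1[` all of whose actions on fibres are generated by involutions and
elements of `recLow i`. -/
noncomputable def fiberSubgroup (i : Fin d) : Subgroup (Equiv.Perm UnitIco) :=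
  -- Taking all base sets B at once lets one rearrangement of [0,1[ be applied over the base of any
  -- rectangle.
  ⨅ B : {B : Set (Cube d) // IsStep (fun x : Cube d => Function.update x i 0 ∈ B)},
    (involutionSubgroup d ⊔ recLow i).comap (fiberPerm i B)

theorem mem_fiberSubgroup {i : Fin d} {s : Equiv.Perm UnitIco} :
    s ∈ fiberSubgroup i ↔ ∀ B : Set (Cube d), IsStep (fun x : Cube d => Function.update x i 0 ∈ B) →
      fiberPerm i B s ∈ involutionSubgroup d ⊔ recLow i := by
  simp [fiberSubgroup, Subgroup.mem_iInf]

/-- The exchange is supported in a slab of width p + q ≤ 1/4, whatever the base B. -/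
theorem rot_mem_fiberSubgroup (i : Fin d) {c p q : ℝ} (hc : 0 ≤ c) (hp : 0 ≤ p) (hq : 0 ≤ q)
    (h : c + p + q ≤ 1) (hpq : p + q ≤ 1 / 4) : rot c p q hc hp hq h ∈ fiberSubgroup i := by
  refine mem_fiberSubgroup.2 fun B hB => ?_
  refine mem_sup_recLow_of_slab (a := c) (l := p + q) (add_nonneg hp hq) hpq (by linarith)
    ⟨fiberPerm_mem_rec (isStep_rot i hc hp hq h) hB, fun x hx => ?_⟩
  by_cases hxB : Function.update x i 0 ∈ B
  · rw [fiberPerm_apply_of_mem _ hxB]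
    rw [show rot c p q hc hp hq h (x i) = x i from Subtype.ext ?_, Function.update_eq_self]
    change rotFun c p q (x i) = x i
    unfold rotFun
    simp only [Set.mem_ofPred_eq, not_and, not_lt] at hx
    split_ifs with h1 h2 h3
    · rfl
    · linarith [hx (not_lt.1 h1)]
    · linarith [hx (not_lt.1 h1)]
    · rfl
  · exact fiberPerm_apply_of_notMem _ hxB


/-! ### Tilings of intervals, encoded as words. -/

section Words

variable {κ : Type*}

/-- The total length of a word in tiles of lengths `e`. -/
def wordLength (e : κ → ℝ) (w : List κ) : ℝ := (w.map e).sum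

/-- In the tiling of the half-line given by the word `w`, the type of the tile that contains `t`
and the position of `t` in this tile. -/
noncomputable def tileLabel (e : κ → ℝ) : List κ → ℝ → Option κ × ℝ
  | [], t => (none, t)
  | a :: w, t => if t < e a then (some a, t) else tileLabel e w (t - e a)

variable {e : κ → ℝ}

@[simp] theorem wordLength_nil : wordLength e [] = 0 := rfl

@[simp] theorem wordLength_cons (a : κ) (w : List κ) :
    wordLength e (a :: w) = e a + wordLength e w := by
  simp [wordLength]

@[simp] theorem wordLength_append (u w : List κ) :
    wordLength e (u ++ w) = wordLength e u + wordLength e w := by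
  simp [wordLength]

theorem wordLength_nonneg (he : ∀ a, 0 < e a) (w : List κ) : 0 ≤ wordLength e w := by
  induction w with
  | nil => simp
  | cons a w ih => simpa using add_nonneg (he a).le ih

theorem wordLength_perm {u w : List κ} (h : u.Perm w) : wordLength e u = wordLength e w :=
  (h.map e).sum_eq

theorem tileLabel_append_left (u w : List κ) {t : ℝ} (ht : t < wordLength e u) (h0 : 0 ≤ t) :
    tileLabel e (u ++ w) t = tileLabel e u t := by
  induction u generalizing t with
  | nil => simp at ht; linarith
  | cons a u ih =>
    simp only [List.cons_append, tileLabel]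
    split_ifs with h
    · rfl
    · rw [wordLength_cons] at ht
      exact ih (by linarith) (by linarith)

theorem tileLabel_append_right (he : ∀ a, 0 < e a) (u w : List κ) {t : ℝ}
    (ht : wordLength e u ≤ t) :
    tileLabel e (u ++ w) t = tileLabel e w (t - wordLength e u) := by
  induction u generalizing t with
  | nil => simp
  | cons a u ih =>
    rw [wordLength_cons] at ht
    have := wordLength_nonneg he u
    rw [List.cons_append, tileLabel, if_neg (by linarith), ih (by linarith), wordLength_cons]
    congr 1
    ring

theorem exists_tileLabel_eq_some (u : List κ) {t : ℝ} (ht : t < wordLength e u) (h0 : 0 ≤ t) :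
    ∃ a ∈ u, (tileLabel e u t).1 = some a := by
  induction u generalizing t with
  | nil => simp at ht; linarith
  | cons a u ih =>
    simp only [tileLabel]
    split_ifs with h
    · exact ⟨a, by simp, rfl⟩
    · rw [wordLength_cons] at ht
      obtain ⟨b, hb, h⟩ := ih (t := t - e a) (by linarith) (by linarith)
      exact ⟨b, by simp [hb], h⟩

/-- Two tilings of an interval by the same small tiles differ by an interval exchange in
`fiberSubgroup i`. -/
theorem exists_rearrangement {d : ℕ} (i : Fin d) (he : ∀ a, 0 < e a) (he' : ∀ a, e a ≤ 1 / 8)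
    {w w' : List κ} (h : w.Perm w') :
    ∀ c : ℝ, 0 ≤ c → c + wordLength e w ≤ 1 → ∃ s ∈ fiberSubgroup i,
      (∀ t : UnitIco, ¬ (c ≤ t ∧ (t : ℝ) < c + wordLength e w) → s t = t) ∧
      ∀ t : UnitIco, c ≤ t → c ≤ s t ∧ tileLabel e w' (s t - c) = tileLabel e w (t - c) := by
  induction h with
  | nil => exact fun c _ _ => ⟨1, one_mem _, fun t _ => rfl, fun t ht => ⟨ht, rfl⟩⟩
  | @cons a w w' h ih =>
    intro c hc hc'
    rw [wordLength_cons] at hc'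
    have ha := he a
    obtain ⟨s, hs, hs1, hs2⟩ := ih (c + e a) (by linarith) (by linarith)
    refine ⟨s, hs, fun t ht => hs1 t fun ht' => ht ⟨by linarith [ht'.1], ?_⟩, fun t ht => ?_⟩
    · rw [wordLength_cons]
      linarith [ht'.2]
    · rcases lt_or_ge (t : ℝ) (c + e a) with h1 | h1
      · rw [hs1 t (fun h => by linarith [h.1])]
        refine ⟨ht, ?_⟩
        simp only [tileLabel]
        rw [if_pos (by linarith), if_pos (by linarith)]
      · obtain ⟨h2, h3⟩ := hs2 t h1
        refine ⟨by linarith, ?_⟩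
        simp only [tileLabel]
        rw [if_neg (by linarith), if_neg (by linarith), sub_sub, sub_sub]
        exact h3
  -- Two adjacent tiles have total length at most 1/4, which is what `rot_mem_fiberSubgroup` needs;
  -- this is the reason for the bound 1/8.
  | swap a b w =>
    intro c hc hc'
    simp only [wordLength_cons] at hc'
    have ha := he a
    have hb := he b
    have hw := wordLength_nonneg he w
    refine ⟨rot c (e b) (e a) hc hb.le ha.le (by linarith),
      rot_mem_fiberSubgroup i hc hb.le ha.le _ (by linarith [he' a, he' b]), fun t ht => ?_,
      fun t ht => ?_⟩
    · refine Subtype.ext ?_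
      change rotFun c (e b) (e a) t = t
      simp only [wordLength_cons, not_and, not_lt] at ht
      unfold rotFun
      split_ifs with h1 h2 h3
      · rfl
      · linarith [ht (not_lt.1 h1)]
      · linarith [ht (not_lt.1 h1)]
      · rfl
    · change c ≤ rotFun c (e b) (e a) t ∧ tileLabel e (a :: b :: w) (rotFun c (e b) (e a) t - c) =
        tileLabel e (b :: a :: w) (t - c)
      unfold rotFun
      rw [if_neg (not_lt.2 ht)]
      simp only [tileLabel]
      split_ifs <;> (try (exfalso; linarith)) <;> refine ⟨by linarith, ?_⟩ <;>
        first | rfl | (congr 1; ring)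
  -- Labels are controlled for all t ≥ c, also beyond the end of the word, so that the two exchanges
  -- compose without an upper bound on the intermediate point.
  | @trans w₁ w₂ w₃ h12 h23 ih1 ih2 =>
    intro c hc hc'
    obtain ⟨s, hs, hs1, hs2⟩ := ih1 c hc hc'
    have hl := wordLength_perm (e := e) h12
    obtain ⟨r, hr, hr1, hr2⟩ := ih2 c hc (hl ▸ hc')
    refine ⟨r * s, mul_mem hr hs, fun t ht => ?_, fun t ht => ?_⟩
    · rw [Equiv.Perm.mul_apply, hs1 t ht, hr1 t (hl ▸ ht)]
    · obtain ⟨h1, h2⟩ := hs2 t ht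
      obtain ⟨h3, h4⟩ := hr2 _ h1
      exact ⟨h3, h4.trans h2⟩

variable {ι : Type*} {e : ι → ℝ}

/-- A word in two copies of a set of tiles is balanced if it contains as many tiles of each type
from the first copy as from the second. -/
def IsBalanced (w : List (ι × Bool)) : Prop :=
  ∀ [DecidableEq ι], ∀ a : ι, w.count (a, false) = w.count (a, true)

theorem IsBalanced.append {u w : List (ι × Bool)} (hu : IsBalanced u) (hw : IsBalanced w) :
    IsBalanced (u ++ w) := by
  intro _ a
  simp [hu a, hw a]

theorem IsBalanced.of_append_left {u w : List (ι × Bool)} (hu : IsBalanced u)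
    (hw : IsBalanced (u ++ w)) : IsBalanced w := by
  intro _ a
  have := hw a
  simpa [hu a] using this

/-- A word followed by its copy. -/
def doubleWord (u : List ι) : List (ι × Bool) := u.map (·, false) ++ u.map (·, true)

theorem isBalanced_doubleWord (u : List ι) : IsBalanced (doubleWord u) := by
  intro _ a
  have h1 : ∀ b : Bool, (u.map (·, b)).count (a, b) = u.count a := fun b =>
    List.count_map_of_injective u (·, b) (fun x y h => (Prod.mk.inj h).1) a
  have h2 : ∀ b : Bool, (u.map (·, b)).count (a, !b) = 0 := fun b =>
    List.count_eq_zero.2 (by simp)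
  have h3 := h2 false
  have h4 := h2 true
  simp only [Bool.not_false, Bool.not_true] at h3 h4
  rw [doubleWord, List.count_append, List.count_append, h1, h1, h3, h4, add_comm]

theorem wordLength_map_mk (u : List ι) (b : Bool) :
    wordLength (fun k : ι × Bool => e k.1) (u.map (·, b)) = wordLength e u := by
  simp [wordLength, Function.comp_def]

theorem wordLength_doubleWord (u : List ι) :
    wordLength (fun k : ι × Bool => e k.1) (doubleWord u) = 2 * wordLength e u := by
  rw [doubleWord, wordLength_append, wordLength_map_mk, wordLength_map_mk, two_mul]

theorem wordLength_eq_sum [Fintype ι] [DecidableEq ι] (w : List (ι × Bool)) :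
    wordLength (fun k : ι × Bool => e k.1) w = ∑ k : ι × Bool, w.count k • e k.1 := by
  induction w with
  | nil => simp
  | cons b w ih => simp [List.count_cons, add_smul, Finset.sum_add_distrib, ih, add_comm]

theorem IsBalanced.wordLength_eq [Fintype ι] [DecidableEq ι] {w : List (ι × Bool)}
    (hw : IsBalanced w) :
    wordLength (fun k : ι × Bool => e k.1) w = ∑ a, ((2 * w.count (a, false) : ℕ) : ℚ) • e a := by
  rw [wordLength_eq_sum, Fintype.sum_prod_type]
  refine Finset.sum_congr rfl fun a _ => ?_
  rw [Fintype.sum_bool, ← hw a, Nat.cast_smul_eq_nsmul, two_mul, add_smul]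

/-- Independence recovers from the length the number of tiles of each type, both copies together;
balance splits this number evenly between the copies. -/
theorem IsBalanced.perm [Fintype ι] (hli : LinearIndependent ℚ e) {u w : List (ι × Bool)}
    (hu : IsBalanced u) (hw : IsBalanced w)
    (h : wordLength (fun k : ι × Bool => e k.1) u = wordLength (fun k : ι × Bool => e k.1) w) :
    u.Perm w := by
  classical
  rw [hu.wordLength_eq, hw.wordLength_eq] at h
  have key := Fintype.linearIndependent_iffₛ.1 hli _ _ h
  have key' : ∀ a, u.count (a, false) = w.count (a, false) := fun a => by
    have := key a
    norm_cast at this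
    omega
  refine List.perm_iff_count.2 ?_
  rintro ⟨a, _ | _⟩
  · exact key' a
  · rw [← hu a, ← hw a, key' a]

/-- If all differences of points of a finite set of cutting points can be tiled, then there is a
tiling compatible with all cutting points. -/
theorem exists_word_of_cuts (C : Finset ℝ) (hC : ∀ c ∈ C, 0 ≤ c)
    (h : ∀ c ∈ insert 0 C, ∀ c' ∈ insert 0 C, c < c' → ∃ u : List ι, 2 * wordLength e u = c' - c) :
    ∃ W : List (ι × Bool), IsBalanced W ∧ wordLength (fun k : ι × Bool => e k.1) W ∈ insert 0 C ∧
      ∀ c ∈ C, ∃ p, p <+: W ∧ IsBalanced p ∧ wordLength (fun k : ι × Bool => e k.1) p = c := by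
  classical
  induction C using Finset.induction_on_max with
  | empty => exact ⟨[], fun _ => by simp, by simp, by simp⟩
  | insert a s hs ih =>
    have hsub : insert 0 s ⊆ insert 0 (insert a s) :=
      Finset.insert_subset_insert _ (Finset.subset_insert _ _)
    obtain ⟨W, hW, hWl, hWp⟩ := ih (fun c hc => hC c (Finset.mem_insert_of_mem hc))
      fun c hc c' hc' => h c (hsub hc) c' (hsub hc')
    have hle : wordLength (fun k : ι × Bool => e k.1) W ≤ a := by
      rcases Finset.mem_insert.1 hWl with h0 | h0
      · rw [h0]
        exact hC a (Finset.mem_insert_self _ _)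
      · exact (hs _ h0).le
    have hex : ∃ D, IsBalanced D ∧ wordLength (fun k : ι × Bool => e k.1) (W ++ D) = a := by
      rcases hle.eq_or_lt with heq | hlt
      · exact ⟨[], fun _ => by simp, by simpa using heq⟩
      -- The gap between the end of the tiling so far and the new largest cut is filled with a word
      -- followed by its copy.
      · obtain ⟨u, hu⟩ := h _ (hsub hWl) a (by simp) hlt
        refine ⟨doubleWord u, isBalanced_doubleWord u, ?_⟩
        rw [wordLength_append, wordLength_doubleWord, hu]
        ring
    obtain ⟨D, hD, hDl⟩ := hex
    refine ⟨W ++ D, hW.append hD, by rw [hDl]; simp, fun c hc => ?_⟩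
    rcases Finset.mem_insert.1 hc with rfl | hc
    · exact ⟨W ++ D, List.prefix_rfl, hW.append hD, hDl⟩
    · obtain ⟨p, hp, hpb⟩ := hWp c hc
      exact ⟨p, hp.trans (List.prefix_append _ _), hpb⟩

theorem exists_factor_of_prefix (he : ∀ a, 0 < e a) {W p q : List (ι × Bool)} (hp : p <+: W)
    (hq : q <+: W) (hpb : IsBalanced p) (hqb : IsBalanced q)
    (h : wordLength (fun k : ι × Bool => e k.1) p < wordLength (fun k : ι × Bool => e k.1) q) :
    ∃ u r, IsBalanced u ∧ W = p ++ (u ++ r) ∧ wordLength (fun k : ι × Bool => e k.1) u =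
      wordLength (fun k : ι × Bool => e k.1) q - wordLength (fun k : ι × Bool => e k.1) p := by
  rcases List.prefix_or_prefix_of_prefix hp hq with ⟨u, rfl⟩ | ⟨u, rfl⟩
  · obtain ⟨r, rfl⟩ := hq
    exact ⟨u, r, hpb.of_append_left hqb, by simp, by simp⟩
  · rw [wordLength_append] at h
    have := wordLength_nonneg (e := fun k : ι × Bool => e k.1) (fun k => he k.1) u
    linarith

end Words


/-! ### Rationally independent tile lengths. -/

open Submodule in
-- A subtractive Euclidean step: replacing x_j by x_j - r x_i with r = -a_i / a_j kills the
-- coefficient of x_i in the relation, and x_j is recovered as a nonnegative combination. Since the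
-- x_i are positive, a nontrivial relation always has terms of both signs, so the process can only
-- stop by dropping a vector.
theorem exists_independent_of_relation {n : ℕ}
    (hn : ∀ (ι : Type) [Fintype ι] (x : ι → ℝ), Fintype.card ι < n → (∀ i, 0 < x i) →
      ∃ (κ : Type) (_ : Fintype κ) (e : κ → ℝ), (∀ k, 0 < e k) ∧ LinearIndependent ℚ e ∧
        ∀ i, x i ∈ span ℚ≥0 (Set.range e))
    {ι : Type} [Fintype ι] [DecidableEq ι] (hι : Fintype.card ι = n) (m : ℕ) :
    ∀ (x : ι → ℝ) (a : ι → ℚ), (∀ i, 0 < x i) → ∑ i, (a i : ℝ) * x i = 0 → (∃ i, a i ≠ 0) →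
      (Finset.univ.filter fun i => a i ≠ 0).card < m →
      ∃ (κ : Type) (_ : Fintype κ) (e : κ → ℝ), (∀ k, 0 < e k) ∧ LinearIndependent ℚ e ∧
        ∀ i, x i ∈ span ℚ≥0 (Set.range e) := by
  induction m with
  | zero => exact fun _ _ _ _ _ h => absurd h (Nat.not_lt_zero _)
  | succ m ih =>
    intro x a hx hsum ⟨i₀, hi₀⟩ hm
    -- two terms of opposite signs, and a multiple of the first below the second
    have hpair : ∃ i j, ∃ r : ℚ≥0, a i ≠ 0 ∧ a j ≠ 0 ∧ i ≠ j ∧ a i = -(r : ℚ) * a j ∧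
        (r : ℝ) * x i ≤ x j := by
      have hpos : ∃ i, 0 < a i := by
        by_contra! hcon
        have hle : ∀ i ∈ Finset.univ, (a i : ℝ) * x i ≤ 0 := fun i _ =>
          mul_nonpos_of_nonpos_of_nonneg (by exact_mod_cast hcon i) (hx i).le
        have := (Finset.sum_eq_zero_iff_of_nonpos hle).1 hsum i₀ (Finset.mem_univ _)
        rcases mul_eq_zero.1 this with h | h
        · exact hi₀ (by exact_mod_cast h)
        · exact (hx i₀).ne' h
      have hneg : ∃ i, a i < 0 := by
        by_contra! hcon
        have hle : ∀ i ∈ Finset.univ, 0 ≤ (a i : ℝ) * x i := fun i _ =>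
          mul_nonneg (by exact_mod_cast hcon i) (hx i).le
        have := (Finset.sum_eq_zero_iff_of_nonneg hle).1 hsum i₀ (Finset.mem_univ _)
        rcases mul_eq_zero.1 this with h | h
        · exact hi₀ (by exact_mod_cast h)
        · exact (hx i₀).ne' h
      obtain ⟨p, hp⟩ := hpos
      obtain ⟨q, hq⟩ := hneg
      have hpq : p ≠ q := by
        rintro rfl
        exact lt_asymm hp hq
      have hr1 : 0 ≤ -a p / a q := (div_pos_of_neg_of_neg (by linarith) hq).le
      have hr2 : 0 ≤ -a q / a p := (div_pos (by linarith) hp).le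
      rcases le_total (((-a p / a q : ℚ) : ℝ) * x p) (x q) with h | h
      · refine ⟨p, q, ⟨-a p / a q, hr1⟩, hp.ne', hq.ne, hpq, ?_, ?_⟩
        · rw [NNRat.coe_mk]
          field_simp [hq.ne]
        · exact h
      · refine ⟨q, p, ⟨-a q / a p, hr2⟩, hq.ne, hp.ne', hpq.symm, ?_, ?_⟩
        · rw [NNRat.coe_mk]
          field_simp [hp.ne']
        · have hp' : (0 : ℝ) < a p := by exact_mod_cast hp
          have hq' : (a q : ℝ) < 0 := by exact_mod_cast hq
          change ((-a q / a p : ℚ) : ℝ) * x q ≤ x p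
          push_cast at h ⊢
          rw [div_mul_eq_mul_div, div_le_iff₀ hp']
          rw [div_mul_eq_mul_div, le_div_iff_of_neg hq'] at h
          linarith
    obtain ⟨i, j, r, hi, hj, hij, har, hle⟩ := hpair
    have smul_eq : ∀ y : ℝ, r • y = (r : ℝ) * y := fun y => NNRat.smul_def r y
    -- Under equality x_j is a multiple of x_i and can be dropped, giving a smaller family;
    -- otherwise the difference is still positive and the relation gets shorter.
    rcases hle.eq_or_lt with heq | hlt
    · obtain ⟨κ, hκ, e, he, hli, hmem⟩ := hn {k // k ≠ j} (fun k => x k)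
        (by rw [← hι]; exact Fintype.card_subtype_lt (x := j) (by simp)) fun k => hx k
      refine ⟨κ, hκ, e, he, hli, fun k => ?_⟩
      by_cases hk : k = j
      · subst hk
        rw [← heq, ← smul_eq]
        exact smul_mem _ _ (hmem ⟨i, hij⟩)
      · exact hmem ⟨k, hk⟩
    · have hx' : ∀ k, 0 < Function.update x j (x j - r * x i) k := fun k => by
        by_cases hk : k = j
        · subst hk
          simpa using hlt
        · simpa [hk] using hx k
      have hsum' : ∑ k, (Function.update a i 0 k : ℝ) *
          Function.update x j (x j - r * x i) k = 0 := by
        have h1 : ∀ k, (Function.update a i 0 k : ℝ) * Function.update x j (x j - r * x i) k =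
            a k * x k + (if k = j then -(a j * r * x i) else 0) - if k = i then a i * x i else 0 := by
          intro k
          by_cases hki : k = i
          · subst hki
            simp [hij]
          · by_cases hkj : k = j
            · subst hkj
              simp [hki]
              ring
            · simp [hki, hkj]
        have har' : (a i : ℝ) = -(r : ℝ) * a j := by
          have := congrArg (Rat.cast : ℚ → ℝ) har
          push_cast at this
          exact this
        simp only [h1, Finset.sum_sub_distrib, Finset.sum_add_distrib, hsum, Finset.sum_ite_eq',
          Finset.mem_univ, if_true, har']
        ring
      have hm' : (Finset.univ.filter fun k => Function.update a i 0 k ≠ 0).card < m := by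
        refine lt_of_lt_of_le (Finset.card_lt_card ?_) (Nat.lt_succ_iff.1 hm)
        refine Finset.ssubset_iff_subset_ne.2 ⟨fun k hk => ?_, fun h => ?_⟩
        · by_cases hki : k = i
          · subst hki
            simp at hk
          · simpa [hki] using hk
        · have : i ∈ Finset.univ.filter fun k => a k ≠ 0 := by simpa using hi
          rw [← h] at this
          simp at this
      obtain ⟨κ, hκ, e, he, hli, hmem⟩ := ih _ _ hx' hsum' ⟨j, by simpa [hij.symm] using hj⟩ hm'
      refine ⟨κ, hκ, e, he, hli, fun k => ?_⟩
      by_cases hk : k = j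
      · subst hk
        have h1 := hmem k
        have h2 := hmem i
        rw [Function.update_self] at h1
        rw [Function.update_of_ne hij] at h2
        have := add_mem h1 (smul_mem _ r h2)
        rwa [smul_eq, sub_add_cancel] at this
      · simpa [hk] using hmem k

open Submodule in
/-- Finitely many positive reals are nonnegative rational combinations of positive reals that are
linearly independent over `ℚ`. -/
theorem exists_independent_of_pos (n : ℕ) : ∀ (ι : Type) [Fintype ι] (x : ι → ℝ),
    Fintype.card ι < n → (∀ i, 0 < x i) →
      ∃ (κ : Type) (_ : Fintype κ) (e : κ → ℝ), (∀ k, 0 < e k) ∧ LinearIndependent ℚ e ∧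
        ∀ i, x i ∈ span ℚ≥0 (Set.range e) := by
  classical
  induction n with
  | zero => exact fun _ _ _ h => absurd h (Nat.not_lt_zero _)
  | succ n ih =>
    intro ι _ x hcard hx
    by_cases hli : LinearIndependent ℚ x
    · exact ⟨ι, inferInstance, x, hx, hli, fun i => subset_span ⟨i, rfl⟩⟩
    · rw [Fintype.not_linearIndependent_iff] at hli
      obtain ⟨a, ha, hne⟩ := hli
      refine exists_independent_of_relation (n := Fintype.card ι)
        (fun ι' _ x' h => ih ι' x' (by omega)) rfl _ x a hx ?_ hne (Nat.lt_succ_self _)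
      simpa [Rat.smul_def] using ha

theorem exists_nat_smul_eq_of_mem_span {κ : Type} [Fintype κ] {e : κ → ℝ} {x : ℝ}
    (hx : x ∈ Submodule.span ℚ≥0 (Set.range e)) :
    ∃ N : ℕ, 0 < N ∧ ∃ n : κ → ℕ, N * x = ∑ k, n k * e k := by
  classical
  induction hx using Submodule.span_induction with
  | mem x hx =>
    obtain ⟨k, rfl⟩ := hx
    exact ⟨1, one_pos, fun l => if l = k then 1 else 0, by simp⟩
  | zero => exact ⟨1, one_pos, 0, by simp⟩
  | add x y _ _ hx hy =>
    obtain ⟨N, hN, n, hn⟩ := hx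
    obtain ⟨M, hM, m, hm⟩ := hy
    refine ⟨N * M, Nat.mul_pos hN hM, fun k => M * n k + N * m k, ?_⟩
    have : ∀ k, ((M * n k + N * m k : ℕ) : ℝ) * e k = M * (n k * e k) + N * (m k * e k) :=
      fun k => by push_cast; ring
    simp only [this, Finset.sum_add_distrib, ← Finset.mul_sum, ← hn, ← hm]
    push_cast
    ring
  | smul q x _ hx =>
    obtain ⟨N, hN, n, hn⟩ := hx
    refine ⟨q.den * N, Nat.mul_pos q.den_pos hN, fun k => q.num * n k, ?_⟩
    have : ∀ k, ((q.num * n k : ℕ) : ℝ) * e k = q.num * (n k * e k) :=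
      fun k => by push_cast; ring
    simp only [this, ← Finset.mul_sum, ← hn]
    rw [NNRat.smul_def, NNRat.cast_def]
    have : (q.den : ℝ) ≠ 0 := by exact_mod_cast q.den_pos.ne'
    push_cast
    field_simp

theorem exists_word_wordLength_eq {κ : Type} [Fintype κ] (e : κ → ℝ) (n : κ → ℕ) :
    ∃ u : List κ, wordLength e u = ∑ k, n k * e k := by
  refine ⟨Finset.univ.toList.flatMap fun k => List.replicate (n k) k, ?_⟩
  rw [← Finset.sum_map_toList]
  induction (Finset.univ : Finset κ).toList with
  | nil => simp
  | cons a l ih => rw [List.flatMap_cons, wordLength_append, ih]; simp [wordLength]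

/-- Finitely many positive reals can be tiled by (an even number of) small tiles with rationally
independent lengths. -/
theorem exists_small_tiles (F : Finset ℝ) (hF : ∀ x ∈ F, 0 < x) :
    ∃ (κ : Type) (_ : Fintype κ) (e : κ → ℝ), (∀ k, 0 < e k) ∧ (∀ k, e k ≤ 1 / 8) ∧
      LinearIndependent ℚ e ∧ ∀ x ∈ F, ∃ u : List κ, 2 * wordLength e u = x := by
  obtain ⟨κ, hκ, e, he, hli, hmem⟩ := exists_independent_of_pos (F.card + 1) (Fin F.card)
    (fun i => (F.equivFin.symm i : ℝ)) (by simp) fun i => hF _ (F.equivFin.symm i).2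
  have hmem' : ∀ x : F, ∃ N : ℕ, 0 < N ∧ ∃ n : κ → ℕ, N * (x : ℝ) = ∑ k, n k * e k := fun x =>
    exists_nat_smul_eq_of_mem_span (by simpa using hmem (F.equivFin x))
  choose N hN n hn using hmem'
  obtain ⟨K, hK⟩ := exists_nat_gt (∑ k, 8 * e k)
  -- The product clears all denominators, K + 1 makes the tiles at most 1/8, and the factor 2 makes
  -- every count even.
  set M : ℕ := 2 * ((K + 1) * ∏ x, N x) with hM
  have hprod : 0 < ∏ x, N x := Finset.prod_pos fun x _ => hN x
  have hM0 : (0 : ℝ) < M := by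
    rw [hM]
    exact_mod_cast Nat.mul_pos two_pos (Nat.mul_pos K.succ_pos hprod)
  refine ⟨κ, hκ, fun k => e k / M, fun k => div_pos (he k) hM0, fun k => ?_, ?_, fun x hx => ?_⟩
  · rw [div_le_iff₀ hM0]
    have h1 : 8 * e k ≤ ∑ k, 8 * e k :=
      Finset.single_le_sum (f := fun k => 8 * e k) (fun k _ => by linarith [he k])
        (Finset.mem_univ k)
    have h2 : K ≤ M := by
      have : 1 ≤ ∏ x, N x := hprod
      rw [hM]
      nlinarith
    have h3 : (K : ℝ) ≤ M := by exact_mod_cast h2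
    linarith
  · have hu : IsUnit ((M : ℚ)⁻¹) := by
      rw [isUnit_iff_ne_zero]
      have : (M : ℚ) ≠ 0 := by
        intro h
        apply hM0.ne'
        exact_mod_cast h
      exact inv_ne_zero this
    have := hli.units_smul fun _ => hu.unit
    convert this using 2 with k
    rw [Pi.smul_apply']
    simp [Units.smul_def, Rat.smul_def, div_eq_inv_mul]
  · obtain ⟨c, hc⟩ : N ⟨x, hx⟩ ∣ ∏ x, N x := Finset.dvd_prod_of_mem N (Finset.mem_univ _)
    obtain ⟨u, hu⟩ := exists_word_wordLength_eq (fun k => e k / M)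
      (fun k => (K + 1) * c * n ⟨x, hx⟩ k)
    refine ⟨u, ?_⟩
    have h1 : ∀ k, (((K + 1) * c * n ⟨x, hx⟩ k : ℕ) : ℝ) * (e k / M) =
        ((K + 1) * c / M) * (n ⟨x, hx⟩ k * e k) := fun k => by
      push_cast
      ring
    rw [hu]
    simp only [h1, ← Finset.mul_sum, ← hn]
    have hM' : (M : ℝ) = 2 * ((K + 1) * (N ⟨x, hx⟩ * c)) := by
      rw [hM, hc]
      push_cast
      ring
    rw [hM'] at hM0 ⊢
    have hne := hM0.ne'
    have h2 : (K + 1 : ℝ) ≠ 0 := fun h => hne (by rw [h]; ring)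
    have h3 : (c : ℝ) ≠ 0 := fun h => hne (by rw [h]; ring)
    have h4 : (N ⟨x, hx⟩ : ℝ) ≠ 0 := fun h => hne (by rw [h]; ring)
    field_simp


/-! ### Reduction of a rectangle exchange to half of the cube. -/

/-- Elements of a subgroup supported in the pieces of a finite partition can be glued. -/
theorem exists_glue {X : Type*} {G : Subgroup (Equiv.Perm X)} {P : Set (Set X)} (hPf : P.Finite)
    (hP : Setoid.IsPartition P) {Q : X → X → Prop}
    (h : ∀ R ∈ P, ∃ g ∈ G, (∀ x ∉ R, g x = x) ∧ ∀ x ∈ R, Q x (g x)) :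
    ∃ g ∈ G, ∀ x, Q x (g x) := by
  have key : ∀ S : Set (Set X), S.Finite → S ⊆ P → ∃ g ∈ G, (∀ R ∈ S, ∀ x ∈ R, Q x (g x)) ∧
      ∀ x, (∀ R ∈ S, x ∉ R) → g x = x := by
    intro S hS
    induction S, hS using Set.Finite.induction_on with
    | empty => exact fun _ => ⟨1, one_mem _, by simp, fun _ _ => rfl⟩
    | @insert A S hA _ ih =>
      intro hsub
      obtain ⟨g, hg, hg1, hg2⟩ := ih ((Set.subset_insert _ _).trans hsub)
      obtain ⟨r, hr, hr1, hr2⟩ := h A (hsub (Set.mem_insert _ _))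
      have hAS : ∀ x ∈ A, ∀ R ∈ S, x ∉ R := fun x hx R hR hxR => hA (by
        rwa [partition_eq_of_mem hP (hsub (Set.mem_insert _ _))
          (hsub (Set.mem_insert_of_mem _ hR)) hx hxR])
      have hrA : ∀ x ∈ A, r x ∈ A := fun x hx => by
        by_contra hcon
        rw [r.injective (hr1 _ hcon)] at hcon
        exact hcon hx
      refine ⟨g * r, mul_mem hg hr, ?_, fun x hx => ?_⟩
      · rintro R (rfl | hR) x hx
        · rw [Equiv.Perm.mul_apply, hg2 _ (hAS _ (hrA x hx))]
          exact hr2 x hx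
        · rw [Equiv.Perm.mul_apply, hr1 x fun hxA => hAS x hxA R hR hx]
          exact hg1 R hR x hx
      · rw [Equiv.Perm.mul_apply, hr1 x (hx A (Set.mem_insert _ _)),
          hg2 x fun R hR => hx R (Set.mem_insert_of_mem _ hR)]
  obtain ⟨g, hg, hg1, -⟩ := key P hPf subset_rfl
  refine ⟨g, hg, fun x => ?_⟩
  obtain ⟨R, ⟨hR, hx⟩, -⟩ := hP.2 x
  exact hg1 R hR x hx

/-- Such a map is the product of its restrictions to the two halves, and the upper factor is
conjugate to a lower one by an involution. -/
theorem mem_sup_of_preserves_low {i : Fin d} {f : Equiv.Perm (Cube d)} (hf : f ∈ Rec d)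
    (h : ∀ x, (f x i : ℝ) < 1 / 2 ↔ (x i : ℝ) < 1 / 2) :
    f ∈ involutionSubgroup d ⊔ recLow i := by
  have h1 : restrictPerm f {x | (x i : ℝ) < 1 / 2} h ∈ recLow i :=
    ⟨restrictPerm_mem_rec hf h (IsStep.lt_const i _),
      fun x hx => restrictPerm_apply_of_notMem h hx⟩
  have h2 : (restrictPerm f {x | (x i : ℝ) < 1 / 2} h)⁻¹ * f ∈ recHigh i := by
    refine ⟨mul_mem (inv_mem h1.1) hf, fun x hx => ?_⟩
    rw [Equiv.Perm.mul_apply, Equiv.Perm.inv_eq_iff_eq]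
    have hx' : (x i : ℝ) < 1 / 2 := not_le.1 fun h' => hx h'
    exact (restrictPerm_apply_of_mem (U := {x : Cube d | (x i : ℝ) < 1 / 2}) h hx').symm
  have := mul_mem (le_sup_right (a := involutionSubgroup d) h1) (recHigh_le_sup_recLow i h2)
  rwa [mul_inv_cancel_left] at this

theorem interval_translate_bounds {a b v : ℝ} (ha : 0 ≤ a) (hab : a < b) (hb : b ≤ 1)
    (h : ∀ t : UnitIco, a ≤ t → (t : ℝ) < b → 0 ≤ (t : ℝ) + v ∧ (t : ℝ) + v < 1) :
    0 ≤ a + v ∧ b + v ≤ 1 := by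
  refine ⟨(h ⟨a, ha, hab.trans_le hb⟩ le_rfl hab).1, ?_⟩
  by_contra! hcon
  -- If b + v > 1, this point of [a,b[ would be translated to 1 or beyond.
  have h1 : max a (1 - v) < b := max_lt hab (by linarith)
  have h2 := (h ⟨max a (1 - v), ha.trans (le_max_left _ _), h1.trans_le hb⟩ (le_max_left _ _) h1).2
  have h3 := le_max_right a (1 - v)
  simp only at h2
  linarith

/-- A rectangle exchange is, on each piece of a partition, a product with a side in direction `i`
that is translated inside `[0,1]`. -/
theorem exists_sides_of_mem_rec (i : Fin d) {f : Equiv.Perm (Cube d)} (hf : f ∈ Rec d) :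
    ∃ P : Set (Set (Cube d)), P.Finite ∧ Setoid.IsPartition P ∧ ∃ a b v : Set (Cube d) → ℝ,
      ∀ R ∈ P, 0 ≤ a R ∧ a R < b R ∧ b R ≤ 1 ∧ 0 ≤ a R + v R ∧ b R + v R ≤ 1 ∧
        ∃ B : Set (Cube d), IsStep (fun x => Function.update x i 0 ∈ B) ∧
          (∀ x, x ∈ R ↔ Function.update x i 0 ∈ B ∧ a R ≤ x i ∧ (x i : ℝ) < b R) ∧
          ∀ x ∈ R, (f x i : ℝ) = x i + v R := by
  obtain ⟨P, hPf, hP, hPI⟩ := hf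
  refine ⟨P, hPf, hP, ?_⟩
  have key : ∀ R : Set (Cube d), ∃ a b v : ℝ, R ∈ P →
      0 ≤ a ∧ a < b ∧ b ≤ 1 ∧ 0 ≤ a + v ∧ b + v ≤ 1 ∧
        ∃ B : Set (Cube d), IsStep (fun x => Function.update x i 0 ∈ B) ∧
          (∀ x, x ∈ R ↔ Function.update x i 0 ∈ B ∧ a ≤ x i ∧ (x i : ℝ) < b) ∧
          ∀ x ∈ R, (f x i : ℝ) = x i + v := by
    intro R
    by_cases hR : R ∈ P
    · obtain ⟨⟨I, hI, rfl⟩, w, hw⟩ := hPI R hR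
      obtain ⟨a, b, ha, hab, hb, hIi⟩ := hI i
      set B : Set (Cube d) := {y | ∀ j, j ≠ i → y j ∈ I j} with hB
      have hBstep : IsStep (fun x : Cube d => Function.update x i 0 ∈ B) := by
        have h1 : IsStep (fun x : Cube d => fun j => x j ∈ I j) :=
          IsStep.pi fun j => IsStep.mem_interval (hI j) j
        refine h1.of_factor fun x y hxy => eq_iff_iff.2 ?_
        refine forall_congr' fun j => forall_congr' fun hj => ?_
        rw [Function.update_of_ne hj, Function.update_of_ne hj]
        exact eq_iff_iff.1 (congrFun hxy j)
      have hmem : ∀ x, x ∈ Set.univ.pi I ↔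
          Function.update x i 0 ∈ B ∧ a ≤ x i ∧ (x i : ℝ) < b := by
        intro x
        have hi : x i ∈ I i ↔ a ≤ x i ∧ (x i : ℝ) < b := by
          rw [hIi]
          rfl
        rw [← hi]
        constructor
        · intro h
          refine ⟨fun j hj => ?_, h i trivial⟩
          rw [Function.update_of_ne hj]
          exact h j trivial
        · rintro ⟨h1, h2⟩ j -
          by_cases hj : j = i
          · rw [hj]
            exact h2
          · have := h1 j hj
            rwa [Function.update_of_ne hj] at this
      have hbounds : 0 ≤ a + w i ∧ b + w i ≤ 1 := by
        refine interval_translate_bounds ha hab hb fun t h1 h2 => ?_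
        choose p hp using fun j => interval_nonempty (hI j)
        have hq : Function.update p i t ∈ Set.univ.pi I := by
          rw [hmem]
          refine ⟨fun j hj => ?_, by simpa using h1, by simpa using h2⟩
          simpa [hj] using hp j
        have h3 := hw _ hq i
        rw [Function.update_self] at h3
        rw [← h3]
        exact (f (Function.update p i t) i).2
      exact ⟨a, b, w i, fun _ => ⟨ha, hab, hb, hbounds.1, hbounds.2, B, hBstep, hmem,
        fun x hx => hw x hx i⟩⟩
    -- Irrelevant values, which make the sides and the displacement total functions of the set.
    · exact ⟨0, 0, 0, fun h => absurd h hR⟩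
  choose a b v h using key
  exact ⟨a, b, v, h⟩

/-- Modulo the involutions, every rectangle exchange is supported in half of the cube. -/
theorem rec_le_sup_recLow (i : Fin d) : Rec d ≤ involutionSubgroup d ⊔ recLow i := by
  classical
  intro f hf
  obtain ⟨P, hPf, hP, a, b, v, hPR⟩ := exists_sides_of_mem_rec i hf
  set S : Finset (Set (Cube d)) := hPf.toFinset with hS
  -- The cuts are the endpoints of the sides of the pieces and of their images; 1 is added so that
  -- the tiling fills [0,1[.
  set C : Finset ℝ := insert 1 (S.image a ∪ S.image b ∪ S.image (fun R => a R + v R) ∪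
    S.image (fun R => b R + v R)) with hC
  have hmemC : ∀ R ∈ P, a R ∈ C ∧ b R ∈ C ∧ a R + v R ∈ C ∧ b R + v R ∈ C := by
    intro R hR
    have hRS : R ∈ S := hPf.mem_toFinset.2 hR
    simp only [hC, Finset.mem_insert, Finset.mem_union]
    exact ⟨by simp [Finset.mem_image_of_mem a hRS], by simp [Finset.mem_image_of_mem b hRS],
      by simp [Finset.mem_image_of_mem (fun R => a R + v R) hRS],
      by simp [Finset.mem_image_of_mem (fun R => b R + v R) hRS]⟩
  have hC01 : ∀ c ∈ C, 0 ≤ c ∧ c ≤ 1 := by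
    intro c hc
    simp only [hC, Finset.mem_insert, Finset.mem_union, Finset.mem_image] at hc
    rcases hc with rfl | (((⟨R, hR, rfl⟩ | ⟨R, hR, rfl⟩) | ⟨R, hR, rfl⟩) | ⟨R, hR, rfl⟩)
    · norm_num
    all_goals
      obtain ⟨h1, h2, h3, h4, h5, -⟩ := hPR R (hPf.mem_toFinset.1 hR)
      constructor <;> linarith
  set F : Finset ℝ := ((insert 0 C ×ˢ insert 0 C).image fun p => p.2 - p.1).filter (0 < ·) with hF
  have hmemF : ∀ c ∈ insert 0 C, ∀ c' ∈ insert 0 C, c < c' → c' - c ∈ F := by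
    intro c hc c' hc' hlt
    rw [hF, Finset.mem_filter]
    exact ⟨Finset.mem_image.2 ⟨(c, c'), Finset.mem_product.2 ⟨hc, hc'⟩, rfl⟩, sub_pos.2 hlt⟩
  obtain ⟨κ, _, e, he, he', hli, hFe⟩ := exists_small_tiles F fun x hx => (Finset.mem_filter.1 hx).2
  set e' : κ × Bool → ℝ := fun k => e k.1 with hee
  have hpos : ∀ k, 0 < e' k := fun k => he k.1
  have hsmall : ∀ k, e' k ≤ 1 / 8 := fun k => he' k.1
  obtain ⟨W, hWb, hWl, hWp⟩ := exists_word_of_cuts C (fun c hc => (hC01 c hc).1)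
    fun c hc c' hc' hlt => hFe _ (hmemF c hc c' hc' hlt)
  have h1C : (1 : ℝ) ∈ C := by simp [hC]
  have hWle : wordLength e' W ≤ 1 := by
    rcases Finset.mem_insert.1 hWl with h | h
    · rw [h]
      norm_num
    · exact (hC01 _ h).2
  have hW1 : wordLength e' W = 1 := by
    refine le_antisymm hWle ?_
    obtain ⟨p, ⟨q, rfl⟩, -, hp⟩ := hWp 1 h1C
    rw [wordLength_append]
    linarith [wordLength_nonneg hpos q]
  -- a rearrangement of the tiles in each piece that makes `f` compatible with the tiling
  obtain ⟨ρ, hρ, hρf⟩ : ∃ ρ ∈ involutionSubgroup d ⊔ recLow i,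
      ∀ x, tileLabel e' W (f (ρ x) i) = tileLabel e' W (x i) := by
    refine exists_glue (Q := fun x y => tileLabel e' W (f y i) = tileLabel e' W (x i)) hPf hP
      fun R hR => ?_
    obtain ⟨h0a, hab, hb1, h0v, hv1, B, hB, hRB, hfv⟩ := hPR R hR
    obtain ⟨hac, hbc, havc, hbvc⟩ := hmemC R hR
    obtain ⟨p, hp, hpb, hpl⟩ := hWp _ hac
    obtain ⟨q, hq, hqb, hql⟩ := hWp _ hbc
    obtain ⟨p', hp', hpb', hpl'⟩ := hWp _ havc
    obtain ⟨q', hq', hqb', hql'⟩ := hWp _ hbvc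
    obtain ⟨u, r, hub, hWu, hul⟩ := exists_factor_of_prefix he hp hq hpb hqb
      (by rw [hpl, hql]; exact hab)
    obtain ⟨u', r', hub', hWu', hul'⟩ := exists_factor_of_prefix he hp' hq' hpb' hqb'
      (by rw [hpl', hql']; linarith)
    rw [hpl, hql] at hul
    rw [hpl', hql', add_sub_add_right_eq_sub] at hul'
    -- The side of R and its translate are intervals of the same length between cuts, so they
    -- consist of the same tiles.
    have hperm : u.Perm u' := hub.perm hli hub' (hul.trans hul'.symm)
    obtain ⟨s, hs, hs1, hs2⟩ := exists_rearrangement (e := e') i hpos hsmall hperm (a R) h0a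
      (by rw [hul]; linarith)
    rw [hul] at hs1
    simp only [add_sub_cancel] at hs1
    refine ⟨fiberPerm i B s, mem_fiberSubgroup.1 hs B hB, fun x hx => ?_, fun x hx => ?_⟩
    · by_cases hxB : Function.update x i 0 ∈ B
      · rw [fiberPerm_apply_of_mem s hxB, hs1 (x i) fun h => hx ((hRB x).2 ⟨hxB, h⟩),
          Function.update_eq_self]
      · exact fiberPerm_apply_of_notMem s hxB
    · obtain ⟨hxB, hxa, hxb⟩ := (hRB x).1 hx
      obtain ⟨hsa, hlab⟩ := hs2 (x i) hxa
      -- Since s fixes every point outside [a R, b R[, injectivity prevents it from moving a point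
      -- of this interval out.
      have hsb : (s (x i) : ℝ) < b R := by
        by_contra hcon
        have := s.injective (hs1 (s (x i)) fun h => hcon h.2)
        rw [this] at hcon
        exact hcon hxb
      have hmem : fiberPerm i B s x ∈ R := by
        rw [hRB, fiberPerm_apply_of_mem s hxB]
        simp only [Function.update_idem, Function.update_self]
        exact ⟨hxB, hsa, hsb⟩
      rw [hfv _ hmem, fiberPerm_apply_of_mem s hxB, Function.update_self]
      have e1 : tileLabel e' W ((s (x i) : ℝ) + v R) = tileLabel e' u' (s (x i) - a R) := by
        rw [hWu', tileLabel_append_right hpos _ _ (by rw [hpl']; linarith), hpl',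
          add_sub_add_right_eq_sub, tileLabel_append_left _ _ (by rw [hul']; linarith)
          (by linarith)]
      have e2 : tileLabel e' W (x i) = tileLabel e' u (x i - a R) := by
        rw [hWu, tileLabel_append_right hpos _ _ (by rw [hpl]; linarith), hpl,
          tileLabel_append_left _ _ (by rw [hul]; linarith) (by linarith)]
      rw [e1, e2, hlab]
  -- rearrange the tiles so that the two halves of the cube have disjoint sets of types
  obtain ⟨u, hu⟩ := hFe 1 (by simpa using hmemF 0 (by simp) 1 (by simp [h1C]) one_pos)
  have hperm : W.Perm (doubleWord u) := hWb.perm hli (isBalanced_doubleWord u) (by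
    rw [wordLength_doubleWord, hu]
    exact hW1)
  obtain ⟨s, hs, -, hs2⟩ := exists_rearrangement (e := e') i hpos hsmall hperm 0 le_rfl
    (by rw [hW1, zero_add])
  simp only [sub_zero] at hs2
  have hlab : ∀ t : UnitIco, tileLabel e' (doubleWord u) (s t) = tileLabel e' W t :=
    fun t => (hs2 t t.2.1).2
  set σ := fiberPerm i Set.univ s with hσ
  have hσmem : σ ∈ involutionSubgroup d ⊔ recLow i := mem_fiberSubgroup.1 hs _
    ((IsStep.const True).of_factor fun _ _ _ => by simp)
  have hGR : involutionSubgroup d ⊔ recLow i ≤ Rec d :=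
    sup_le involutionSubgroup_le_rec fun _ h => h.1
  have hσi : ∀ x, σ x i = s (x i) := fun x => by
    rw [hσ, fiberPerm_univ_apply, Function.update_self]
  -- In the rearranged tiling, the lower half is the union of the tiles from the first copy, so it
  -- can be read off from the label.
  have hlow : ∀ t : UnitIco, (t : ℝ) < 1 / 2 ↔
      ∃ k, (tileLabel e' (doubleWord u) t).1 = some (k, false) := by
    intro t
    have hhalf : ∀ c : Bool, wordLength e' (u.map (·, c)) = 1 / 2 := fun c => by
      rw [hee, wordLength_map_mk]
      linarith
    constructor
    · intro ht
      rw [doubleWord, tileLabel_append_left _ _ (by rw [hhalf]; exact ht) t.2.1]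
      obtain ⟨k, hk, h⟩ := exists_tileLabel_eq_some (e := e') (u.map (·, false)) (t := t)
        (by rw [hhalf]; exact ht) t.2.1
      obtain ⟨l, -, rfl⟩ := List.mem_map.1 hk
      exact ⟨l, h⟩
    · rintro ⟨k, hk⟩
      by_contra! ht
      rw [doubleWord, tileLabel_append_right hpos _ _ (by rw [hhalf]; exact ht), hhalf] at hk
      obtain ⟨k', hk', h⟩ := exists_tileLabel_eq_some (e := e') (u.map (·, true))
        (t := (t : ℝ) - 1 / 2) (by rw [hhalf]; linarith [t.2.2]) (by linarith)
      obtain ⟨l, -, rfl⟩ := List.mem_map.1 hk'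
      rw [hk] at h
      simp at h
  -- The map f ρ preserves labels of W, so its conjugate preserves labels of the doubled word, hence
  -- the lower half.
  have hconj : σ * (f * ρ) * σ⁻¹ ∈ involutionSubgroup d ⊔ recLow i := by
    refine mem_sup_of_preserves_low
      (mul_mem (mul_mem (hGR hσmem) (mul_mem hf (hGR hρ))) (inv_mem (hGR hσmem))) fun x => ?_
    obtain ⟨y, rfl⟩ := σ.surjective x
    rw [hlow, hlow, Equiv.Perm.mul_apply, Equiv.Perm.mul_apply,
      show σ⁻¹ (σ y) = y from σ.symm_apply_apply y, hσi, hσi, hlab, hlab, Equiv.Perm.mul_apply,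
      hρf]
  rw [show f = σ⁻¹ * (σ * (f * ρ) * σ⁻¹) * σ * ρ⁻¹ by group]
  exact mul_mem (mul_mem (mul_mem (inv_mem hσmem) hconj) hσmem) (inv_mem hρ)

theorem commutator_rec_le (hd : 1 ≤ d) : derivedRec d ≤ involutionSubgroup d := by
  let i : Fin d := ⟨0, hd⟩
  refine commutator_le_of_le_sup (A := recLow i) (B := recHigh i) involutionSubgroup_le_rec
    (fun r hr n hn => conj_mem_involutionSubgroup hr hn) (fun _ h => h.1) (fun _ h => h.1)
    (rec_le_sup_recLow i) ?_ fun a ha b hb => commute_of_mem_recLow_recHigh ha hb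
  exact (rec_le_sup_recLow i).trans (sup_le le_sup_left (recLow_le_sup_recHigh i))

theorem derivedRec_le_GtG (hd : 1 ≤ d) : derivedRec d ≤ GtG d :=
  ((commutator_rec_le hd).trans involutionSubgroup_le_closure).trans
    (Subgroup.closure_mono Set.subset_union_right)

-- The conjugate g n g⁻¹ equals ⁅g, n⁆ n, and `GtG d` contains all commutators.
open scoped commutatorElement in
theorem normal_GtG (hd : 1 ≤ d) : ((GtG d).subgroupOf (Rec d)).Normal := by
  refine ⟨fun n hn g => ?_⟩
  rw [Subgroup.mem_subgroupOf] at hn ⊢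
  have h : ⁅(g : Equiv.Perm (Cube d)), (n : Equiv.Perm (Cube d))⁆ ∈ GtG d :=
    derivedRec_le_GtG hd (Subgroup.commutator_mem_commutator g.2 n.2)
  have := mul_mem h hn
  rw [commutatorElement_def] at this
  simpa using this


/-! ### Translation invariant finitely additive functionals. -/

theorem linearIndependent_initialSegments :
    LinearIndependent ℝ fun c : Set.Ioc (0 : ℝ) 1 =>
      Set.indicator {x : UnitIco | (x : ℝ) < c} (1 : UnitIco → ℝ) := by
  rw [linearIndependent_iff']
  intro s g
  induction s using Finset.induction_on_max with
  | empty => simp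
  | insert a s hs ih =>
    intro h
    -- At the second largest endpoint (or at 0), only the longest initial segment has a nonzero
    -- indicator, which isolates its coefficient.
    obtain ⟨x, hxa, hxs⟩ : ∃ x : UnitIco, (x : ℝ) < a ∧ ∀ c ∈ s, (c : ℝ) ≤ x := by
      rcases s.eq_empty_or_nonempty with rfl | hne
      · exact ⟨⟨0, le_rfl, one_pos⟩, a.2.1, by simp⟩
      · have hlt : s.max' hne < a := hs _ (s.max'_mem hne)
        exact ⟨⟨s.max' hne, (s.max' hne).2.1.le, lt_of_lt_of_le hlt a.2.2⟩, hlt,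
          fun c hc => s.le_max' c hc⟩
    have ha : a ∉ s := fun h => lt_irrefl _ (hs a h)
    rw [Finset.sum_insert ha] at h
    have hga : g a = 0 := by
      have h' := congrFun h x
      rw [Pi.add_apply, Finset.sum_apply, Finset.sum_eq_zero] at h'
      · simpa [Set.indicator, hxa] using h'
      · intro c hc
        simp [Set.indicator, not_lt.2 (hxs c hc)]
    rw [hga, zero_smul, zero_add] at h
    intro c hc
    rcases Finset.mem_insert.1 hc with rfl | hc
    · exact hga
    · exact ih h c hc

theorem exists_linearMap_of_linearIndependent {K V W ι : Type*} [Field K] [AddCommGroup V]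
    [Module K V] [AddCommGroup W] [Module K W] {v : ι → V} (hv : LinearIndependent K v)
    (g : ι → W) : ∃ L : V →ₗ[K] W, ∀ i, L (v i) = g i := by
  obtain ⟨L, hL⟩ := LinearMap.exists_extend
    ((Finsupp.linearCombination K g) ∘ₗ (hv.repr : Submodule.span K (Set.range v) →ₗ[K] ι →₀ K))
  refine ⟨L, fun i => ?_⟩
  have h := LinearMap.congr_fun hL ⟨v i, Submodule.subset_span ⟨i, rfl⟩⟩
  rw [LinearMap.comp_apply, Submodule.subtype_apply] at h
  rw [h, LinearMap.comp_apply]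
  refine (congrArg _ (hv.repr_eq_single i _ rfl)).trans ?_
  rw [Finsupp.linearCombination_single, one_smul]

/-- The half-open interval `[a,b[` in `[0,1[`. -/
def ico (a b : ℝ) : Set UnitIco := {x | a ≤ (x : ℝ) ∧ (x : ℝ) < b}

/-- A finitely additive signed measure on `[0,1[`, defined on all functions, that gives to an
interval the value of an additive function at its length. -/
theorem exists_intervalFunctional (α : ℝ →ₗ[ℚ] ℝ) : ∃ L : (UnitIco → ℝ) →ₗ[ℝ] ℝ,
    ∀ a b : ℝ, 0 ≤ a → a ≤ b → b ≤ 1 → L (Set.indicator (ico a b) 1) = α (b - a) := by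
  -- By independence over ℝ the values on the segments [0,c[ are arbitrary; additivity of α then
  -- gives the values on all intervals.
  obtain ⟨L, hL⟩ := exists_linearMap_of_linearIndependent linearIndependent_initialSegments
    fun c => α c
  have hL' : ∀ c : ℝ, 0 ≤ c → c ≤ 1 →
      L (Set.indicator {x : UnitIco | (x : ℝ) < c} 1) = α c := by
    intro c h0 h1
    rcases h0.eq_or_lt with rfl | h0
    · rw [map_zero, show {x : UnitIco | (x : ℝ) < 0} = ∅ from
        Set.eq_empty_of_forall_notMem fun x hx => not_lt.2 x.2.1 hx, Set.indicator_empty]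
      exact map_zero L
    · exact hL ⟨c, h0, h1⟩
  refine ⟨L, fun a b ha hab hb => ?_⟩
  rw [map_sub, ← hL' a ha (hab.trans hb), ← hL' b (ha.trans hab) hb, ← map_sub]
  congr 1
  funext x
  simp only [Set.indicator, ico, Set.mem_ofPred_eq, Pi.sub_apply, Pi.one_apply]
  split_ifs <;> grind

/-- The product of linear functionals on spaces of all functions. -/
theorem exists_productFunctional {X : Type*} (d : ℕ) :
    ∀ L : Fin d → (X → ℝ) →ₗ[ℝ] ℝ, ∃ M : ((Fin d → X) → ℝ) →ₗ[ℝ] ℝ,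
      ∀ f : Fin d → X → ℝ, M (fun x => ∏ i, f i (x i)) = ∏ i, L i (f i) := by
  induction d with
  | zero => exact fun L => ⟨LinearMap.proj default, fun f => by simp⟩
  | succ d ih =>
    intro L
    obtain ⟨M, hM⟩ := ih fun i => L i.succ
    -- Iterated integration: `L 0` in the first variable, then the product functional in the others.
    -- As all functions are admitted, no measurability intervenes.
    refine ⟨M ∘ₗ LinearMap.pi fun y => L 0 ∘ₗ LinearMap.funLeft ℝ ℝ fun t => Fin.cons t y,
      fun f => ?_⟩
    have h : (LinearMap.pi fun y => L 0 ∘ₗ LinearMap.funLeft ℝ ℝ fun t =>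
        (Fin.cons t y : Fin (d + 1) → X)) (fun x => ∏ i, f i (x i)) =
        L 0 (f 0) • fun y => ∏ i : Fin d, f i.succ (y i) := by
      funext y
      rw [LinearMap.pi_apply, LinearMap.comp_apply, Pi.smul_apply, smul_eq_mul, mul_comm,
        ← smul_eq_mul, ← map_smul]
      congr 1
      funext t
      simp [LinearMap.funLeft_apply, Fin.prod_univ_succ, mul_comm]
    rw [LinearMap.comp_apply, h, map_smul, hM, Fin.prod_univ_succ, smul_eq_mul]

theorem exists_rectangleFunctional (α : Fin d → ℝ →ₗ[ℚ] ℝ) :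
    ∃ L : Fin d → (UnitIco → ℝ) →ₗ[ℝ] ℝ, ∃ M : (Cube d → ℝ) →ₗ[ℝ] ℝ,
      (∀ i, ∀ a b : ℝ, 0 ≤ a → a ≤ b → b ≤ 1 →
        L i (Set.indicator (ico a b) 1) = α i (b - a)) ∧
      ∀ f : Fin d → UnitIco → ℝ, M (fun x => ∏ i, f i (x i)) = ∏ i, L i (f i) := by
  choose L hL using fun i => exists_intervalFunctional (α i)
  obtain ⟨M, hM⟩ := exists_productFunctional d L
  exact ⟨L, M, hL, hM⟩

theorem indicator_pi_eq_prod (I : Fin d → Set UnitIco) :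
    Set.indicator (Set.univ.pi I) (1 : Cube d → ℝ) =
      fun x => ∏ i, Set.indicator (I i) (1 : UnitIco → ℝ) (x i) := by
  classical
  funext x
  simp only [Set.indicator, Set.mem_univ_pi, Pi.one_apply]
  by_cases h : ∀ i, x i ∈ I i
  · simp [h]
  · rw [if_neg h]
    push Not at h
    obtain ⟨i, hi⟩ := h
    exact (Finset.prod_eq_zero (Finset.mem_univ i) (if_neg hi)).symm

/-- A functional on functions on the cube is translation invariant if it takes the same value on
the indicator functions of a rectangle and of its translates. -/
def IsTranslationInvariant (M : (Cube d → ℝ) →ₗ[ℝ] ℝ) : Prop :=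
  ∀ (A : Set (Cube d)) (f : Equiv.Perm (Cube d)), IsRectangle A → IsTranslationOn f A →
    M (Set.indicator (f '' A) 1) = M (Set.indicator A 1)

/-- The value on a rectangle is the product of the α i at its side lengths, which a translation does
not change. -/
theorem isTranslationInvariant_of_prod {α : Fin d → ℝ →ₗ[ℚ] ℝ}
    {L : Fin d → (UnitIco → ℝ) →ₗ[ℝ] ℝ} {M : (Cube d → ℝ) →ₗ[ℝ] ℝ}
    (hL : ∀ i, ∀ a b : ℝ, 0 ≤ a → a ≤ b → b ≤ 1 →
      L i (Set.indicator (ico a b) 1) = α i (b - a))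
    (hM : ∀ f : Fin d → UnitIco → ℝ, M (fun x => ∏ i, f i (x i)) = ∏ i, L i (f i)) :
    IsTranslationInvariant M := by
  rintro _ f ⟨I, hI, rfl⟩ ⟨v, hv⟩
  choose a b ha hab hb hIi using hI
  choose p hp using fun j => interval_nonempty ⟨a j, b j, ha j, hab j, hb j, hIi j⟩
  have hbounds : ∀ i, 0 ≤ a i + v i ∧ b i + v i ≤ 1 := fun i => by
    refine interval_translate_bounds (ha i) (hab i) (hb i) fun t h1 h2 => ?_
    have hq : Function.update p i t ∈ Set.univ.pi I := fun j _ => by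
      by_cases hj : j = i
      · subst hj
        rw [Function.update_self, hIi]
        exact ⟨h1, h2⟩
      · rw [Function.update_of_ne hj]
        exact hp j
    have h3 := hv _ hq i
    rw [Function.update_self] at h3
    rw [← h3]
    exact (f (Function.update p i t) i).2
  have himage : f '' Set.univ.pi I = Set.univ.pi fun i => ico (a i + v i) (b i + v i) := by
    ext y
    constructor
    · rintro ⟨x, hx, rfl⟩ i -
      have h := hx i trivial
      rw [hIi] at h
      have h' := hv x hx i
      constructor <;> linarith [h.1, h.2]
    · intro hy
      have hy' : ∀ i, 0 ≤ (y i : ℝ) - v i ∧ (y i : ℝ) - v i < 1 := fun i => by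
        obtain ⟨h1, h2⟩ := hy i trivial
        constructor <;> linarith [ha i, hb i]
      have hx : (fun i => ⟨(y i : ℝ) - v i, hy' i⟩ : Cube d) ∈ Set.univ.pi I := fun i _ => by
        obtain ⟨h1, h2⟩ := hy i trivial
        rw [hIi]
        constructor <;> simp only <;> linarith
      refine ⟨_, hx, funext fun i => Subtype.ext ?_⟩
      rw [hv _ hx i]
      ring
  rw [himage, indicator_pi_eq_prod, indicator_pi_eq_prod, hM, hM]
  refine Finset.prod_congr rfl fun i _ => ?_
  rw [hL i _ _ (hbounds i).1 (by linarith [hab i]) (hbounds i).2, hIi,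
    show {x : UnitIco | a i ≤ (x : ℝ) ∧ (x : ℝ) < b i} = ico (a i) (b i) from rfl,
    hL i _ _ (ha i) (hab i).le (hb i), add_sub_add_right_eq_sub]

/-- On a partition where g is a translation and h ∘ g is constant on each piece C, h ∘ g is a
combination of the indicators of the C, and h is the same combination of the indicators of the
translates g C. -/
theorem IsTranslationInvariant.map_comp {M : (Cube d → ℝ) →ₗ[ℝ] ℝ} (hM : IsTranslationInvariant M)
    {h : Cube d → ℝ} (hh : IsStep h) {g : Equiv.Perm (Cube d)} (hg : g ∈ Rec d) :
    M (fun x => h (g x)) = M h := by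
  obtain ⟨P, hPf, hP, hPI⟩ := (hh.comp_rec hg).prodMk (mem_rec_iff.1 hg)
  have hne : ∀ C ∈ P, C.Nonempty := fun C hC =>
    Set.nonempty_iff_ne_empty.2 fun h0 => hP.1 (h0 ▸ hC)
  have : ∀ C : Set (Cube d), ∃ c : ℝ, C ∈ P → ∀ x ∈ C, h (g x) = c := fun C => by
    by_cases hC : C ∈ P
    · obtain ⟨x, hx⟩ := hne C hC
      exact ⟨h (g x), fun _ y hy => (Prod.mk.inj ((hPI C hC).2 y hy x hx)).1⟩
    · exact ⟨0, fun h => absurd h hC⟩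
  choose c hc using this
  have hsum : ∀ x, h (g x) = ∑ C ∈ hPf.toFinset, c C * Set.indicator C 1 x := by
    intro x
    obtain ⟨C, ⟨hC, hxC⟩, -⟩ := hP.2 x
    rw [Finset.sum_eq_single_of_mem C (hPf.mem_toFinset.2 hC)]
    · rw [Set.indicator_of_mem hxC, hc C hC x hxC, Pi.one_apply, mul_one]
    · intro D hD hDC
      rw [Set.indicator_of_notMem, mul_zero]
      exact fun hxD => hDC (partition_eq_of_mem hP (hPf.mem_toFinset.1 hD) hC hxD hxC)
  have e1 : (fun x => h (g x)) = ∑ C ∈ hPf.toFinset, c C • Set.indicator C 1 := by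
    funext x
    rw [hsum, Finset.sum_apply]
    rfl
  have e2 : h = ∑ C ∈ hPf.toFinset, c C • Set.indicator (g '' C) 1 := by
    funext y
    obtain ⟨x, rfl⟩ := g.surjective y
    rw [hsum, Finset.sum_apply]
    refine Finset.sum_congr rfl fun C _ => ?_
    rw [Pi.smul_apply, smul_eq_mul]
    congr 1
    by_cases hx : x ∈ C
    · rw [Set.indicator_of_mem hx, Set.indicator_of_mem (Set.mem_image_of_mem g hx)]
      rfl
    · rw [Set.indicator_of_notMem hx, Set.indicator_of_notMem]
      rwa [g.injective.mem_set_image]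
  rw [e1]
  conv_rhs => rw [e2]
  rw [map_sum, map_sum]
  refine Finset.sum_congr rfl fun C hC => ?_
  have hC' := hPf.mem_toFinset.1 hC
  rw [map_smul, map_smul, hM C g (hPI C hC').1]
  obtain ⟨x, hx⟩ := hne C hC'
  refine ⟨fun j => (g x j : ℝ) - x j, fun y hy j => ?_⟩
  have := congrFun (Prod.mk.inj ((hPI C hC').2 y hy x hx)).2 j
  simp only at this ⊢
  linarith

/-! ### The displacement invariant. -/

/-- The generalized Sah–Arnoux–Fathi invariant: the integral, with respect to a translation
invariant functional, of an additive function of the `i`-th coordinate of the displacement. -/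
noncomputable def displacementIntegral (M : (Cube d → ℝ) →ₗ[ℝ] ℝ) (β : ℝ →ₗ[ℚ] ℝ) (i : Fin d)
    (f : Equiv.Perm (Cube d)) : ℝ :=
  M fun x => β ((f x i : ℝ) - x i)

/-- The displacement is a cocycle: that of f g at x is the displacement of f at g x plus that of g
at x, and `IsTranslationInvariant.map_comp` removes the g in the first term. -/
theorem displacementIntegral_mul {M : (Cube d → ℝ) →ₗ[ℝ] ℝ} (hM : IsTranslationInvariant M)
    (β : ℝ →ₗ[ℚ] ℝ) (i : Fin d) {f g : Equiv.Perm (Cube d)} (hf : f ∈ Rec d) (hg : g ∈ Rec d) :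
    displacementIntegral M β i (f * g) =
      displacementIntegral M β i f + displacementIntegral M β i g := by
  have hstep : IsStep (fun x => β ((f x i : ℝ) - x i)) :=
    (mem_rec_iff.1 hf).of_factor fun x y h => by
      exact congrArg β (congrFun h i)
  unfold displacementIntegral
  rw [← hM.map_comp hstep hg, ← map_add]
  congr 1
  funext x
  rw [Pi.add_apply, ← map_add, Equiv.Perm.mul_apply, sub_add_sub_cancel]

/-- The displacement integral as a homomorphism. -/
noncomputable def displacementHom {M : (Cube d → ℝ) →ₗ[ℝ] ℝ} (hM : IsTranslationInvariant M)
    (β : ℝ →ₗ[ℚ] ℝ) (i : Fin d) : Rec d →* Multiplicative ℝ :=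
  MonoidHom.mk' (fun f => Multiplicative.ofAdd (displacementIntegral M β i f)) fun f g =>
    displacementIntegral_mul hM β i f.2 g.2

/-- The rectangle exchanges with vanishing displacement integral. -/
noncomputable def displacementKer {M : (Cube d → ℝ) →ₗ[ℝ] ℝ} (hM : IsTranslationInvariant M)
    (β : ℝ →ₗ[ℚ] ℝ) (i : Fin d) : Subgroup (Equiv.Perm (Cube d)) :=
  (displacementHom hM β i).ker.map (Rec d).subtype

theorem mem_displacementKer {M : (Cube d → ℝ) →ₗ[ℝ] ℝ} {hM : IsTranslationInvariant M}
    {β : ℝ →ₗ[ℚ] ℝ} {i : Fin d} {f : Equiv.Perm (Cube d)} :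
    f ∈ displacementKer hM β i ↔ f ∈ Rec d ∧ displacementIntegral M β i f = 0 := by
  constructor
  · rintro ⟨g, hg, rfl⟩
    exact ⟨g.2, hg⟩
  · rintro ⟨hf, h⟩
    exact ⟨⟨f, hf⟩, h, rfl⟩

theorem derivedRec_le_displacementKer {M : (Cube d → ℝ) →ₗ[ℝ] ℝ} (hM : IsTranslationInvariant M)
    (β : ℝ →ₗ[ℚ] ℝ) (i : Fin d) : derivedRec d ≤ displacementKer hM β i := by
  refine Subgroup.commutator_le.2 fun f hf g hg => ⟨⟨f, hf⟩ * ⟨g, hg⟩ * ⟨f, hf⟩⁻¹ * ⟨g, hg⟩⁻¹,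
    ?_, rfl⟩
  rw [SetLike.mem_coe, MonoidHom.mem_ker]
  simp only [map_mul, map_inv]
  rw [mul_comm (displacementHom hM β i ⟨f, hf⟩), mul_inv_cancel_right, mul_inv_cancel]

/-- The two rectangles have equal measure and opposite displacements, so their contributions cancel.
-/
theorem rectangleTranspositions_subset_displacementKer {M : (Cube d → ℝ) →ₗ[ℝ] ℝ}
    (hM : IsTranslationInvariant M) (β : ℝ →ₗ[ℚ] ℝ) (i : Fin d) :
    rectangleTranspositions d ⊆ displacementKer hM β i := by
  intro τ hτ
  refine mem_displacementKer.2 ⟨rectangleTransposition_mem_rec hτ, ?_⟩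
  obtain ⟨P, Q, hP, -, hdisj, hPQ, hQP, ⟨v, hv⟩, ⟨w, hw⟩, hfix⟩ := hτ
  have hMPQ : M (Set.indicator Q 1) = M (Set.indicator P 1) := by
    rw [← hPQ]
    exact hM P τ hP ⟨v, hv⟩
  have htwice : ∀ x ∈ P, (τ (τ x) i : ℝ) = x i + (v i + w i) := fun x hx => by
    rw [hw _ (hPQ ▸ ⟨x, hx, rfl⟩), hv x hx, add_assoc]
  -- The square of τ translates P onto itself by v + w; comparing the least i-th coordinates in P
  -- forces this translation to vanish in direction i.
  have hvw : v i + w i = 0 := by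
    obtain ⟨I, hI, rfl⟩ := hP
    choose a b ha hab hb hIi using hI
    have hmem : (fun j => ⟨a j, ha j, (hab j).trans_le (hb j)⟩ : Cube d) ∈ Set.univ.pi I :=
      fun j _ => by
        rw [hIi]
        exact ⟨le_rfl, hab j⟩
    have hle : ∀ x ∈ Set.univ.pi I, a i ≤ (x i : ℝ) := fun x hx => by
      have := hx i trivial
      rw [hIi] at this
      exact this.1
    have h1 := htwice _ hmem
    have h2 : τ (τ fun j => ⟨a j, ha j, (hab j).trans_le (hb j)⟩) ∈ Set.univ.pi I :=
      hQP ▸ ⟨_, hPQ ▸ ⟨_, hmem, rfl⟩, rfl⟩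
    have h3 := hle _ h2
    obtain ⟨y, hy, hya⟩ := hQP.symm ▸ hmem
    obtain ⟨z, hz, rfl⟩ := hPQ.symm ▸ hy
    have h4 := htwice z hz
    have h5 := hle z hz
    rw [hya] at h4
    simp only at h1 h4
    linarith
  have hdispl : (fun x => β ((τ x i : ℝ) - x i)) =
      β (v i) • Set.indicator P 1 + β (w i) • Set.indicator Q (1 : Cube d → ℝ) := by
    funext x
    rw [Pi.add_apply, Pi.smul_apply, Pi.smul_apply]
    by_cases hxP : x ∈ P
    · rw [Set.indicator_of_mem hxP, Set.indicator_of_notMem (Set.disjoint_left.1 hdisj hxP),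
        hv x hxP]
      simp
    by_cases hxQ : x ∈ Q
    · rw [Set.indicator_of_mem hxQ, Set.indicator_of_notMem hxP, hw x hxQ]
      simp
    · rw [Set.indicator_of_notMem hxQ, Set.indicator_of_notMem hxP,
        hfix x (by simp [hxP, hxQ])]
      simp
  rw [displacementIntegral, hdispl, map_add, map_smul, map_smul, hMPQ, ← add_smul, ← map_add, hvw,
    map_zero, zero_smul]

/-! ### Strictness of the two inclusions. -/

theorem exists_irrational_functional : ∃ θ : ℝ, 0 < θ ∧ θ < 1 ∧
    ∃ γ : ℝ →ₗ[ℚ] ℝ, γ 1 = 0 ∧ γ θ = 1 := by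
  have h1 : 1 < √2 := Real.lt_sqrt_of_sq_lt (by norm_num)
  have h2 : √2 < 2 := (Real.sqrt_lt' two_pos).2 (by norm_num)
  refine ⟨√2 - 1, by linarith, by linarith, ?_⟩
  have hnot : √2 - 1 ∉ Submodule.span ℚ {(1 : ℝ)} := by
    rw [Submodule.mem_span_singleton]
    rintro ⟨q, hq⟩
    refine irrational_sqrt_two ⟨q + 1, ?_⟩
    rw [Rat.smul_def] at hq
    push_cast
    linarith
  obtain ⟨γ, hγ, hγ'⟩ := LinearMap.exists_extend_of_notMem
    (0 : Submodule.span ℚ {(1 : ℝ)} →ₗ[ℚ] ℝ) hnot 1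
  refine ⟨γ, ?_, hγ'⟩
  exact LinearMap.congr_fun hγ ⟨1, Submodule.mem_span_singleton_self 1⟩

/-- The rotation of `[0,1[` by `θ`. -/
noncomputable def rotation {θ : ℝ} (h0 : 0 < θ) (h1 : θ < 1) : Equiv.Perm UnitIco :=
  rot 0 (1 - θ) θ le_rfl (by linarith) h0.le (by linarith)

theorem rotation_apply {θ : ℝ} (h0 : 0 < θ) (h1 : θ < 1) (t : UnitIco) :
    (rotation h0 h1 t : ℝ) = if (t : ℝ) < 1 - θ then (t : ℝ) + θ else t + (θ - 1) := by
  change rotFun 0 (1 - θ) θ t = _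
  have h2 := t.2.1
  have h3 := t.2.2
  unfold rotFun
  rw [zero_add, if_neg (not_lt.2 h2)]
  split_ifs <;> linarith

theorem rotation_mem_IET {θ : ℝ} (h0 : 0 < θ) (h1 : θ < 1) : rotation h0 h1 ∈ IET := by
  have i1 : IsHalfOpenInterval (ico 0 (1 - θ)) := ⟨0, 1 - θ, le_rfl, by linarith, by linarith, rfl⟩
  have i2 : IsHalfOpenInterval (ico (1 - θ) 1) := ⟨1 - θ, 1, by linarith, by linarith, le_rfl, rfl⟩
  refine ⟨{ico 0 (1 - θ), ico (1 - θ) 1}, by simp, ⟨?_, fun x => ?_⟩, ?_⟩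
  · rintro (h | h)
    · exact (interval_nonempty i1).ne_empty h.symm
    · exact (interval_nonempty i2).ne_empty (Set.mem_singleton_iff.1 h).symm
  · rcases lt_or_ge (x : ℝ) (1 - θ) with hx | hx
    · refine ⟨_, ⟨Or.inl rfl, x.2.1, hx⟩, ?_⟩
      rintro B ⟨rfl | rfl, hB⟩
      · rfl
      · exact absurd hx (not_lt.2 hB.1)
    · refine ⟨_, ⟨Or.inr rfl, hx, x.2.2⟩, ?_⟩
      rintro B ⟨rfl | rfl, hB⟩
      · exact absurd hB.2 (not_lt.2 hx)
      · rfl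
  · rintro I (rfl | rfl)
    · refine ⟨i1, θ, fun x hx => ?_⟩
      rw [rotation_apply, if_pos hx.2]
    · refine ⟨i2, θ - 1, fun x hx => ?_⟩
      rw [rotation_apply, if_neg (not_lt.2 hx.1)]

/-- The displacements θ and θ - 1 differ by 1, which γ does not see. -/
theorem map_rotation_sub {θ : ℝ} (h0 : 0 < θ) (h1 : θ < 1) {γ : ℝ →ₗ[ℚ] ℝ} (hγ : γ 1 = 0)
    (hγ' : γ θ = 1) (t : UnitIco) : γ ((rotation h0 h1 t : ℝ) - t) = 1 := by
  rw [rotation_apply]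
  split_ifs
  · rw [add_sub_cancel_left, hγ']
  · rw [add_sub_cancel_left, map_sub, hγ, hγ', sub_zero]

theorem fiberPerm_univ_mem_GtG (i : Fin d) {s : Equiv.Perm UnitIco} (hs : s ∈ IET) :
    fiberPerm i Set.univ s ∈ GtG d := by
  refine Subgroup.subset_closure (Or.inl ⟨Function.update 1 i s, fun j => ?_, ?_⟩)
  · by_cases hj : j = i
    · subst hj
      rwa [Function.update_self]
    · rw [Function.update_of_ne hj]
      exact one_mem _
  · refine Equiv.ext fun x => funext fun j => ?_
    rw [fiberPerm_univ_apply]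
    by_cases hj : j = i
    · subst hj
      simp
    · simp [hj]

theorem ico_zero_one : ico 0 1 = Set.univ := Set.eq_univ_of_forall fun x => x.2

theorem derivedRec_lt_GtG (hd : 1 ≤ d) : derivedRec d < GtG d := by
  refine lt_of_le_of_ne (derivedRec_le_GtG hd) fun heq => ?_
  obtain ⟨θ, h0, h1, γ, hγ, hγ'⟩ := exists_irrational_functional
  -- With ordinary length on each side, M gives the cube mass 1, so the invariant of the rotation is
  -- 1.
  obtain ⟨L, M, hL, hM⟩ := exists_rectangleFunctional fun _ : Fin d => LinearMap.id
  have hinv := isTranslationInvariant_of_prod hL hM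
  let i : Fin d := ⟨0, hd⟩
  have hmem := fiberPerm_univ_mem_GtG i (rotation_mem_IET h0 h1)
  rw [← heq] at hmem
  have hzero := (mem_displacementKer.1 (derivedRec_le_displacementKer hinv γ i hmem)).2
  have hfun : (fun x : Cube d => γ ((fiberPerm i Set.univ (rotation h0 h1) x i : ℝ) - x i)) =
      fun x => ∏ j : Fin d, Set.indicator (ico 0 1) (1 : UnitIco → ℝ) (x j) := by
    funext x
    rw [fiberPerm_univ_apply, Function.update_self, map_rotation_sub h0 h1 hγ hγ', ico_zero_one]
    simp
  rw [displacementIntegral, hfun, hM fun _ => Set.indicator (ico 0 1) 1] at hzero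
  simp [hL _ 0 1 le_rfl zero_le_one le_rfl] at hzero

theorem GtG_lt_rec (hd : 2 ≤ d) : GtG d < Rec d := by
  refine lt_of_le_of_ne GtG_le_rec fun heq => ?_
  obtain ⟨θ, h0, h1, γ, hγ, hγ'⟩ := exists_irrational_functional
  let i : Fin d := ⟨0, by omega⟩
  let k : Fin d := ⟨1, by omega⟩
  have hik : k ≠ i := by simp [i, k]
  -- Side k is measured by γ: the full side has mass γ 1 = 0, whereas [0,θ[ has mass γ θ = 1.
  obtain ⟨L, M, hL, hM⟩ := exists_rectangleFunctional
    (Function.update (fun _ : Fin d => LinearMap.id) k γ)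
  have hinv := isTranslationInvariant_of_prod hL hM
  have hLk : ∀ b : ℝ, 0 ≤ b → b ≤ 1 → L k (Set.indicator (ico 0 b) 1) = γ b := fun b hb hb' => by
    rw [hL k 0 b le_rfl hb hb', Function.update_self, sub_zero]
  have hle : GtG d ≤ displacementKer hinv γ i := by
    refine (Subgroup.closure_le _).2 (Set.union_subset (fun f hf => ?_)
      (rectangleTranspositions_subset_displacementKer hinv γ i))
    refine mem_displacementKer.2 ⟨coordinatewiseIET_subset_rec hf, ?_⟩
    obtain ⟨s, -, rfl⟩ := hf
    have hfun : (fun x : Cube d => γ ((Equiv.piCongrRight s x i : ℝ) - x i)) = fun x =>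
        ∏ j : Fin d, (Function.update (fun _ => Set.indicator (ico 0 1) 1) i
          (fun t : UnitIco => γ ((s i t : ℝ) - t)) : Fin d → UnitIco → ℝ) j (x j) := by
      funext x
      rw [Finset.prod_eq_single i]
      · simp
      · intro j _ hj
        rw [Function.update_of_ne hj, ico_zero_one]
        simp
      · simp
    rw [displacementIntegral, hfun, hM]
    -- The i-th displacement of a coordinatewise map does not depend on x_k, so integration over
    -- side k gives the factor γ 1 = 0.
    refine Finset.prod_eq_zero (Finset.mem_univ k) ?_
    rw [Function.update_of_ne hik, hLk 1 zero_le_one le_rfl, hγ]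
  have hupd : ∀ x : Cube d, Function.update x i 0 ∈ {y : Cube d | (y k : ℝ) < θ} ↔
      (x k : ℝ) < θ := fun x => by
    rw [Set.mem_ofPred_eq, Function.update_of_ne hik]
  -- The witness outside `GtG d`: coordinate i is rotated by θ only over the slab x_k < θ.
  have hmem : fiberPerm i {y : Cube d | (y k : ℝ) < θ} (rotation h0 h1) ∈ Rec d :=
    fiberPerm_mem_rec (IsStep.displacement_of_mem_IET (rotation_mem_IET h0 h1) i)
      ((IsStep.lt_const k θ).of_factor fun x y h => by rw [hupd, hupd]; exact h)
  rw [← heq] at hmem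
  have hzero := (mem_displacementKer.1 (hle hmem)).2
  have hfun : (fun x : Cube d => γ ((fiberPerm i {y : Cube d | (y k : ℝ) < θ} (rotation h0 h1) x i
      : ℝ) - x i)) = fun x => ∏ j : Fin d, (Function.update (fun _ => Set.indicator (ico 0 1) 1) k
        (Set.indicator (ico 0 θ) 1) : Fin d → UnitIco → ℝ) j (x j) := by
    funext x
    rw [Finset.prod_eq_single k]
    · rw [Function.update_self]
      by_cases hx : (x k : ℝ) < θ
      · rw [fiberPerm_apply_of_mem _ ((hupd x).2 hx), Function.update_self,
          map_rotation_sub h0 h1 hγ hγ', Set.indicator_of_mem (s := ico 0 θ) ⟨(x k).2.1, hx⟩, Pi.one_apply]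
      · rw [fiberPerm_apply_of_notMem _ (fun h => hx ((hupd x).1 h)), sub_self, map_zero,
          Set.indicator_of_notMem fun h => hx h.2]
    · intro j _ hj
      rw [Function.update_of_ne hj, ico_zero_one]
      simp
    · simp
  rw [displacementIntegral, hfun, hM, Finset.prod_eq_one] at hzero
  · exact one_ne_zero hzero
  · intro j _
    by_cases hj : j = k
    · subst hj
      rw [Function.update_self, hLk θ h0.le h1.le, hγ']
    · rw [Function.update_of_ne hj, hL j 0 1 le_rfl zero_le_one le_rfl, Function.update_of_ne hj]
      simp

end RectExchange

theorem mainTheorem6 (d : ℕ) (hd : 1 ≤ d) :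
    RectExchange.GtG d ≤ RectExchange.Rec d ∧
    ((RectExchange.GtG d).subgroupOf (RectExchange.Rec d)).Normal ∧
    RectExchange.derivedRec d ≤ RectExchange.GtG d ∧
    (2 ≤ d → RectExchange.derivedRec d < RectExchange.GtG d ∧
      RectExchange.GtG d < RectExchange.Rec d) :=
  ⟨RectExchange.GtG_le_rec, RectExchange.normal_GtG hd, RectExchange.derivedRec_le_GtG hd,
    fun h => ⟨RectExchange.derivedRec_lt_GtG hd, RectExchange.GtG_lt_rec h⟩⟩
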